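/- Let $(X,d)$ be a complete separable metric space which is a length space (the distance of two points is the infimum of the lengths of the continuous curves joining them), and let $Y\subset X$ be open with $\emptyset\neq Y\neq X$. **Notation.** For $x,y\in X$ put $$d^*(x,y)=\inf_{z\in X\setminus Y}[d(x,z)+d(z,y)],\qquad d'(x,\partial)=\inf_{z\in X\setminus Y}d(x,z),\qquad d^\dagger(x,y)=d'(x,\partial)+d'(y,\partial).$$ On $Y'=Y\cup\{\partial\}$ let $d'(x,y)=\min\{d(x,y),d^\dagger(x,y)\}$ for $x,y\in Y$ and $d'(\partial,x)=d'(x,\partial)$, $d'(\partial,\partial)=0$. Let $\mathcal P^{sub}(Y)$ be the set of Borel measures $\mu$ on $Y$ with $\mu(Y)\le 1$, also regarded as measures on $X$. Let $p\in[1,\infty)$. - For finite measures $\mu,\nu$ let $W_p(\mu,\nu)$, $W_p^*(\mu,\nu)$, $W_p^\dagger(\mu,\nu)$ be $\big(\inf_q\int c^p\,dq\big)^{1/p}$ with $c=d$, $c=d^*$, $c=d^\dagger$, respectively, where $q$ runs over the couplings of $\mu$ and $\nu$; the value is $\infty$ if the masses of $\mu$ and $\nu$ differ. The annihilation cost of $\mu$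 is $W_p^*(\mu)=\frac12W_p^*(\mu,\mu)$. - For $\mu,\nu\in\mathcal P^{sub}(Y)$ let $W'_p(\mu,\nu)$ be the $L^p$-Kantorovich–Wasserstein distance with respect to $d'$ of the probability measures $\mu+(1-\mu(Y))\delta_\partial$ and $\nu+(1-\nu(Y))\delta_\partial$ on $Y'$. - A charged probability measure is a pair $\sigma=(\sigma^+,\sigma^-)$ of Borel measures on $X$ with $\sigma^+|_{X\setminus Y}=\sigma^-|_{X\setminus Y}$ and $\sigma^+(X)+\sigma^-(X)=1$. For two of them let $$\tilde W_p(\sigma,\tau)=\inf\Big\{\int d^p\,dq^{++}+\int (d^*)^p\,dq^{+-}+\int (d^*)^p\,dq^{-+}+\int d^p\,dq^{--}\Big\}^{1/p},$$ where the infimum runs over all measures $q^{ij}$ ($i,j\in\{+,-\}$) on $X\times X$ such that, for each $i$, the first marginals of $q^{i+}$ and $q^{i-}$ add up to $\sigma^i$ and, for each $j$, the second marginals of $q^{+j}$ and $q^{-j}$ add up to $\tau^j$. - For $\mu,\nu\in\mathcal P^{sub}(Y)$ let $W^0_p(\mu,\nu)=\inf\{\tilde W_p(\sigma,\tau):\sigma^+-\sigma^-=\mu,\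 \tau^+-\tau^-=\nu\}$, and let $\mathcal P^{sub}_p(Y)$ be the set of $\mu\in\mathcal P^{sub}(Y)$ with $W^0_p(\mu,\delta_y)<\infty$ for some $y\in Y$. - Let $W_p^\flat(\mu,\nu)$ be the infimum of $\sum_{i=1}^nW^0_p(\eta_{i-1},\eta_i)$ over all finite chains $\mu=\eta_0,\dots,\eta_n=\nu$ in $\mathcal P^{sub}_p(Y)$, and let $W_p^\sharp(\mu,\nu)$ be the infimum of the lengths with respect to $W_p^\flat$ of the $W_p^\flat$-continuous curves $\eta:[0,1]\to\mathcal P^{sub}_p(Y)$ with $\eta_0=\mu$, $\eta_1=\nu$, where the length of $\eta$ is the supremum of $\sum_{i=1}^nW_p^\flat(\eta_{s_{i-1}},\eta_{s_i})$ over all partitions $0=s_0<\dots<s_n=1$. In the decompositions below all $\mu_i$, $\nu_i$ are (nonnegative) measures. **Lemma.** (i) For all $\mu,\nu\in\mathcal P^{sub}_1(Y)$ $$W^0_1(\mu,\nu)=\inf\{W_1(\mu_1,\nu_1)+W_1^*(\mu_0)+W_1^*(\nu_0)\mid \mu=\mu_1+\mu_0,\ \nu=\nu_1+\nu_0,\ (\mu+\nu_0)(X)\le1,\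 (\nu+\mu_0)(X)\le1\}.$$ (ii) For all $p\ge1$ and $\mu,\nu\in\mathcal P^{sub}_p(Y)$ $$W^0_p(\mu,\nu)^p\le\inf\{W_p(\mu_1,\nu_1)^p+W_p^*(\mu_0)^p+W_p^*(\nu_0)^p\mid \mu=\mu_1+\mu_0,\ \nu=\nu_1+\nu_0,\ (\mu+\nu_0)(X)\le1,\ (\nu+\mu_0)(X)\le1\}.$$ (iii) For all $\mu,\nu\in\mathcal P^{sub}_1(Y)$ $$W^\sharp_1(\mu,\nu)=\inf\{W_1(\mu_1,\nu_1)+W_1^*(\mu_0)+W_1^*(\nu_0)\mid \mu=\mu_1+\mu_0,\ \nu=\nu_1+\nu_0\}.$$ (iv) For all $p\ge1$ and $\mu,\nu\in\mathcal P^{sub}_p(Y)$ $$W'_p(\mu,\nu)^p=\inf\{W_p(\mu_1,\nu_1)^p+W_p^\dagger(\mu_2,\nu_2)^p+W'_p(\mu_0,0)^p+W'_p(\nu_0,0)^p\},$$ where the infimum runs over all decompositions $\mu=\mu_1+\mu_2+\mu_0$, $\nu=\nu_1+\nu_2+\nu_0$ with $(\mu+\nu_0)(Y)\le1$ and $(\nu+\mu_0)(Y)\le1$.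 Here $0$ is the zero measure, and $W'_p(\mu_0,0)^p=\int_Yd'(x,\partial)^p\,d\mu_0(x)$ for every $\mu_0\in\mathcal P^{sub}(Y)$. In the case $p=1$ the contributions of $W_1^\dagger$ can be avoided, if the mass constraints are dropped: for all $\mu,\nu\in\mathcal P^{sub}_1(Y)$ $$W'_1(\mu,\nu)=\inf\{W_1(\mu_1,\nu_1)+W'_1(\mu_0,0)+W'_1(\nu_0,0)\mid \mu=\mu_1+\mu_0,\ \nu=\nu_1+\nu_0\}.$$ -/

import Mathlib

open MeasureTheory Set Filter Topology
open scoped ENNReal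

noncomputable section

namespace TransportAnnihilation

/-- A metric space is a length space if the distance of any two points is the infimum of the
lengths of the continuous curves joining them. -/
def IsLengthSpace (X : Type*) [MetricSpace X] : Prop :=
  ∀ x y : X, edist x y = ⨅ γ : Path x y, eVariationOn (fun t : unitInterval => γ t) Set.univ

section Transport

variable {α : Type*} [MeasurableSpace α]

/-- The optimal value of `∫ c(x,y)^p dq(x,y)` over all couplings `q` of `μ` and `ν`
(it is `∞` if there is no coupling, that is, if the masses differ). -/
def transportCost (c : α → α → ℝ≥0∞) (p : ℝ) (μ ν : Measure α) : ℝ≥0∞ :=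
  ⨅ (q : Measure (α × α)) (_ : q.fst = μ) (_ : q.snd = ν), ∫⁻ z, c z.1 z.2 ^ p ∂q

/-- The `L^p`-transportation distance for the cost `c`. -/
def transportDist (c : α → α → ℝ≥0∞) (p : ℝ) (μ ν : Measure α) : ℝ≥0∞ :=
  transportCost c p μ ν ^ (1 / p)

end Transport

variable {X : Type*} [MetricSpace X]

/-- `d*(x,y) = inf { d(x,z) + d(z,y) : z ∈ X \ Y }`. -/
def dStar (Y : Set X) (x y : X) : ℝ≥0∞ :=
  ⨅ z ∈ Yᶜ, (edist x z + edist z y)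

/-- `d'(x,∂) = inf { d(x,z) : z ∈ X \ Y }`. -/
def dBdry (Y : Set X) (x : X) : ℝ≥0∞ :=
  ⨅ z ∈ Yᶜ, edist x z

/-- `d†(x,y) = d'(x,∂) + d'(y,∂)`. -/
def dDagger (Y : Set X) (x y : X) : ℝ≥0∞ :=
  dBdry Y x + dBdry Y y

/-- The one-point completion `Y' = Y ∪ {∂}`; the point `∂` is `Sum.inr ()`. For open `Y`, the
σ-algebra of the disjoint union is the Borel σ-algebra of the metric `dPrime`. -/
abbrev Completion (Y : Set X) : Type _ := Y ⊕ Unit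

/-- The shortcut metric `d'` on `Y' = Y ∪ {∂}`. -/
def dPrime (Y : Set X) : Completion Y → Completion Y → ℝ≥0∞
  | .inl x, .inl y => min (edist (x : X) (y : X)) (dBdry Y x + dBdry Y y)
  | .inl x, .inr _ => dBdry Y x
  | .inr _, .inl y => dBdry Y y
  | .inr _, .inr _ => 0

variable [MeasurableSpace X]

/-- Subprobability measures on `Y`, regarded as measures on `X` that are concentrated on `Y`. -/
def IsSubprob (Y : Set X) (μ : Measure X) : Prop :=
  μ Yᶜ = 0 ∧ μ Set.univ ≤ 1

/-- Charged probability measures `σ = (σ⁺, σ⁻)`: the two parts agree on `X \ Y` and their masses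
add up to one. -/
structure ChargedProb (Y : Set X) where
  /-- the distribution `σ⁺` of the particles -/
  pos : Measure X
  /-- the distribution `σ⁻` of the antiparticles -/
  neg : Measure X
  restrict_eq : pos.restrict Yᶜ = neg.restrict Yᶜ
  mass_eq : pos Set.univ + neg Set.univ = 1

/-- The transportation distance `W̃_p` between charged probability measures. The infimum runs over
all couplings `q = q⁺⁺ + q⁺⁻ + q⁻⁺ + q⁻⁻` of the charged particles, where `q^{ij}` transports
particles of charge `i` to particles of charge `j`: the first marginals of `q^{i+}`, `q^{i-}` add up
to `σ^i`, and the second marginals of `q^{+j}`, `q^{-j}` add up to `τ^j`. -/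
def WTilde (p : ℝ) (Y : Set X) (σ τ : ChargedProb Y) : ℝ≥0∞ :=
  (⨅ (qpp : Measure (X × X)) (qpm : Measure (X × X)) (qmp : Measure (X × X))
      (qmm : Measure (X × X))
      (_ : qpp.fst + qpm.fst = σ.pos) (_ : qmp.fst + qmm.fst = σ.neg)
      (_ : qpp.snd + qmp.snd = τ.pos) (_ : qpm.snd + qmm.snd = τ.neg),
    (∫⁻ z, edist z.1 z.2 ^ p ∂qpp) + (∫⁻ z, dStar Y z.1 z.2 ^ p ∂qpm)
      + (∫⁻ z, dStar Y z.1 z.2 ^ p ∂qmp) + (∫⁻ z, edist z.1 z.2 ^ p ∂qmm)) ^ (1 / p)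

/-- The transportation-annihilation pre-distance `W⁰_p`. The conditions say that the effective
measures are `σ⁺ - σ⁻ = μ` and `τ⁺ - τ⁻ = ν`, written without subtraction. -/
def WZero (p : ℝ) (Y : Set X) (μ ν : Measure X) : ℝ≥0∞ :=
  ⨅ (σ : ChargedProb Y) (τ : ChargedProb Y) (_ : σ.pos = μ + σ.neg) (_ : τ.pos = ν + τ.neg),
    WTilde p Y σ τ

/-- The class `P^sub_p(Y)` of the subprobabilities on `Y` at finite `W⁰_p`-distance from the Dirac
measure at a point of `Y`. -/
def IsSubprobP (p : ℝ) (Y : Set X) (μ : Measure X) : Prop :=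
  IsSubprob Y μ ∧ ∃ y ∈ Y, WZero p Y μ (Measure.dirac y) < ∞

/-- `W♭_p(μ,ν)`: the infimum of `∑ W⁰_p(η_{i-1}, η_i)` over finite chains in `P^sub_p(Y)`. -/
def WFlat (p : ℝ) (Y : Set X) (μ ν : Measure X) : ℝ≥0∞ :=
  ⨅ (n : ℕ) (η : Fin (n + 1) → Measure X) (_ : ∀ i, IsSubprobP p Y (η i))
    (_ : η 0 = μ) (_ : η (Fin.last n) = ν),
    ∑ i : Fin n, WZero p Y (η i.castSucc) (η i.succ)

/-- The `W♭_p`-length of a curve `η`, a supremum over the partitions `0 = s_0 < ⋯ < s_n = 1`. -/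
def flatLength (p : ℝ) (Y : Set X) (η : unitInterval → Measure X) : ℝ≥0∞ :=
  ⨆ (n : ℕ) (s : Fin (n + 1) → unitInterval) (_ : StrictMono s) (_ : s 0 = 0) (_ : s (Fin.last n) = 1),
    ∑ i : Fin n, WFlat p Y (η (s i.castSucc)) (η (s i.succ))

/-- The transportation-annihilation distance `W♯_p`: the infimum of the lengths of the
`W♭_p`-continuous curves in `P^sub_p(Y)` from `μ` to `ν`. -/
def WSharp (p : ℝ) (Y : Set X) (μ ν : Measure X) : ℝ≥0∞ :=
  ⨅ (η : unitInterval → Measure X) (_ : ∀ t, IsSubprobP p Y (η t))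
    (_ : ∀ s, Tendsto (fun t => WFlat p Y (η s) (η t)) (𝓝 s) (𝓝 0))
    (_ : η 0 = μ) (_ : η 1 = ν),
    flatLength p Y η

/-- The Kantorovich-Wasserstein distance `W_p` with respect to `d`. -/
def W (p : ℝ) (μ ν : Measure X) : ℝ≥0∞ :=
  transportDist edist p μ ν

/-- `W†_p`, the transportation distance with respect to `d†`. -/
def WDagger (p : ℝ) (Y : Set X) (μ ν : Measure X) : ℝ≥0∞ :=
  transportDist (dDagger Y) p μ ν

/-- `W*_p(μ,ν)`, the transportation distance with respect to `d*`. -/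
def WStar (p : ℝ) (Y : Set X) (μ ν : Measure X) : ℝ≥0∞ :=
  transportDist (dStar Y) p μ ν

/-- The annihilation cost `W*_p(μ) = ½ W*_p(μ,μ)`. -/
def annihilationCost (p : ℝ) (Y : Set X) (μ : Measure X) : ℝ≥0∞ :=
  WStar p Y μ μ / 2

/-- The extension `μ' = μ + (1 - μ(Y)) δ_∂` of a subprobability on `Y` to a probability on `Y'`. -/
def toCompletion (Y : Set X) (μ : Measure X) : Measure (Completion Y) :=
  (μ.comap (Subtype.val : Y → X)).map Sum.inl + (1 - μ Y) • Measure.dirac (Sum.inr ())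

/-- `W'_p(μ,ν)`: the Kantorovich-Wasserstein distance of `μ'` and `ν'` with respect to `d'`. -/
def WPrime (p : ℝ) (Y : Set X) (μ ν : Measure X) : ℝ≥0∞ :=
  transportDist (dPrime Y) p (toCompletion Y μ) (toCompletion Y ν)

end TransportAnnihilation

end

/-! Upper bounds in (i) and (ii). A plan of `μ₀` with itself pairs points `x` and `y`. In a length
space some curve from `x` to `y` through `X \ Y` has length close to `d*(x,y)`, hence an approximate
midpoint `m`. One of the two points reaches `m` directly, the other through `X \ Y`, each at a cost
of about `d*(x,y)/2`. With half of the mass of each pair sent to `m` as particles and half as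
antiparticles, `μ₀` disappears at a cost close to `annihilationCost p Y μ₀ ^ p`
(`exists_annihilation_plan`). The reversed plan creates `ν₀`; `wZero_rpow_le_decomposition`
assembles the pieces.

Lower bound in (i). In a charged plan between `σ` and `τ`, the transport of antiparticles is read
backwards as a transport of particles. Both marginals of `q⁺⁻` are sent to an extra point `∂`, and
both marginals of `q⁻⁺` come from `∂`; this costs no more, because `d'(x,∂) + d'(y,∂) ≤ d*(x,y)`.
The result is a plan on `X ∪ {∂}` between `μ + r` and `ν + r`, up to masses at `∂`, with `r = σ⁻ +
τ⁻`. For `p = 1` the common part `r` can be cancelled (`transportCost_le_of_cancel`), and a plan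
between what is left is a decomposition of `μ` and `ν` (`constrainedCost_le_wZero`).

Part (iv). A plan on `Y ∪ {∂}` consists of four blocks, and its block in `Y × Y` is cut according to
which of `d` and `d†` is smaller (`wPrime_rpow_eq`). For `p = 1` the pairs that use `d†` may as well
die and be born, and the mass constraints disappear when mass is first killed, then moved, then
created, by the triangle inequality for `W'₁` (`wPrime_one_eq_freeCost`).

Part (iii) is a sandwich: `freeCost = W'₁ ≤ W♭₁ ≤ W♯₁ ≤ freeCost`. The middle inequalities hold
because `W'₁ ≤ W⁰₁` and `W'₁` satisfies the triangle inequality; the last one is the length of the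
linear interpolation. -/

namespace TransportAnnihilation

/-! ### Measurability on disjoint unions -/

section MeasurableSum

variable {α β γ δ ε : Type*} [MeasurableSpace α] [MeasurableSpace β] [MeasurableSpace γ]
  [MeasurableSpace δ] [MeasurableSpace ε]

theorem measurable_sum_prod_sum {f : (α ⊕ β) × (γ ⊕ δ) → ε}
    (h₁ : Measurable fun z : α × γ => f (.inl z.1, .inl z.2))
    (h₂ : Measurable fun z : α × δ => f (.inl z.1, .inr z.2))
    (h₃ : Measurable fun z : β × γ => f (.inr z.1, .inl z.2))
    (h₄ : Measurable fun z : β × δ => f (.inr z.1, .inr z.2)) : Measurable f := by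
  rw [← (MeasurableEquiv.sumProdSum α β γ δ).symm.measurable_comp_iff]
  refine measurable_fun_sum (measurable_fun_sum ?_ ?_) (measurable_fun_sum ?_ ?_)
  · exact h₁
  · exact h₂
  · exact h₃
  · exact h₄

/-- The sum embeds as a measurable subset of `α × Bool`. Gluing of plans on `X ⊕ Unit` and on
`Completion Y` disintegrates measures and therefore needs this. -/
instance standardBorelSpace_sum_unit [StandardBorelSpace α] [Nonempty α] :
    StandardBorelSpace (α ⊕ Unit) := by
  obtain ⟨a⟩ := ‹Nonempty α›
  let f : α ⊕ Unit → α × Bool := Sum.elim (fun x => (x, true)) (fun _ => (a, false))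
  have hf : Measurable f := by fun_prop
  let g : α × Bool → α ⊕ Unit := fun z => if z.2 = true then .inl z.1 else .inr ()
  have hg : Measurable g :=
    Measurable.ite (measurable_snd (measurableSet_singleton true)) (by fun_prop) (by fun_prop)
  have hgf : Function.LeftInverse g f := by rintro (x | x) <;> simp [f, g]
  have hfe : MeasurableEmbedding f := by
    refine MeasurableEmbedding.of_measurable_inverse hf ?_ hg hgf
    have : range f = (univ ×ˢ {true}) ∪ ({a} ×ˢ {false}) := by
      ext ⟨x, b⟩
      cases b <;> simp [f, eq_comm]
    rw [this]
    exact (MeasurableSet.univ.prod (measurableSet_singleton _)).union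
      ((measurableSet_singleton _).prod (measurableSet_singleton _))
  have : StandardBorelSpace (range f) := hfe.measurableSet_range.standardBorel
  let e := hfe.equivRange
  obtain ⟨_, _, _⟩ := this.polish
  let t : TopologicalSpace (α ⊕ Unit) := TopologicalSpace.induced e inferInstance
  have hb : BorelSpace (α ⊕ Unit) :=
    ⟨by rw [borel_comap, ← BorelSpace.measurable_eq, e.measurableEmbedding.comap_eq]⟩
  exact ⟨t, hb, e.toEquiv.polishSpace_induced⟩

end MeasurableSum

/-! ### Splitting measures and plans -/

section Splitting

variable {α β : Type*} [MeasurableSpace α] [MeasurableSpace β]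

theorem withDensity_map {q : Measure α} {π : α → β} (hπ : Measurable π) {f : β → ℝ≥0∞}
    (hf : Measurable f) : (q.withDensity (f ∘ π)).map π = (q.map π).withDensity f := by
  ext s hs
  rw [Measure.map_apply hπ hs, withDensity_apply _ (hπ hs), withDensity_apply _ hs,
    setLIntegral_map hs hf hπ]
  rfl

theorem exists_density_add (a b : Measure α) [IsFiniteMeasure a] [IsFiniteMeasure b] :
    ∃ f g : α → ℝ≥0∞, Measurable f ∧ Measurable g ∧ (a + b).withDensity f = a ∧
      (a + b).withDensity g = b ∧ f + g =ᵐ[a + b] 1 := by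
  refine ⟨a.rnDeriv (a + b), b.rnDeriv (a + b), Measure.measurable_rnDeriv _ _,
    Measure.measurable_rnDeriv _ _, ?_, ?_, ?_⟩
  · exact Measure.withDensity_rnDeriv_eq _ _
      (Measure.absolutelyContinuous_of_le (Measure.le_add_right le_rfl))
  · exact Measure.withDensity_rnDeriv_eq _ _
      (Measure.absolutelyContinuous_of_le (Measure.le_add_left le_rfl))
  · exact (Measure.rnDeriv_add a b (a + b)).symm.trans (Measure.rnDeriv_self _)

/-- A measure can be split along a splitting of its image under a measurable map. -/
theorem exists_add_of_map_eq_add {q : Measure α} {π : α → β} (hπ : Measurable π)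
    {a b : Measure β} [IsFiniteMeasure a] [IsFiniteMeasure b] (h : q.map π = a + b) :
    ∃ q₁ q₂ : Measure α, q = q₁ + q₂ ∧ q₁.map π = a ∧ q₂.map π = b := by
  obtain ⟨f, g, hf, hg, hfa, hgb, hfg⟩ := exists_density_add a b
  -- The densities of `a` and `b` with respect to `a + b`, pulled back along `π`, cut `q`.
  refine ⟨q.withDensity (f ∘ π), q.withDensity (g ∘ π), ?_, ?_, ?_⟩
  · rw [← withDensity_add_left (hf.comp hπ)]
    rw [← h] at hfg
    have := ae_of_ae_map hπ.aemeasurable hfg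
    conv_lhs => rw [← withDensity_one (μ := q)]
    refine withDensity_congr_ae ?_
    filter_upwards [this] with x hx
    exact hx.symm
  · rw [withDensity_map hπ hf, h, hfa]
  · rw [withDensity_map hπ hg, h, hgb]

/-- The Riesz refinement property of finite measures. -/
theorem exists_refinement {a b c d : Measure α} [IsFiniteMeasure c] [IsFiniteMeasure d]
    (h : a + b = c + d) :
    ∃ a₁ a₂ b₁ b₂ : Measure α, a = a₁ + a₂ ∧ b = b₁ + b₂ ∧ c = a₁ + b₁ ∧ d = a₂ + b₂ := by
  -- Both `a` and `b` are cut by the densities of `c` and `d` with respect to the common sum.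
  obtain ⟨f, g, hf, hg, hfc, hgd, hfg⟩ := exists_density_add c d
  rw [← h] at hfc hgd hfg
  have key : ∀ m : Measure α, m ≪ a + b → m = m.withDensity f + m.withDensity g := by
    intro m hm
    rw [← withDensity_add_left hf]
    conv_lhs => rw [← withDensity_one (μ := m)]
    exact withDensity_congr_ae (hm.ae_eq hfg).symm
  refine ⟨a.withDensity f, a.withDensity g, b.withDensity f, b.withDensity g,
    key a ?_, key b ?_, ?_, ?_⟩
  · exact Measure.absolutelyContinuous_of_le (Measure.le_add_right le_rfl)
  · exact Measure.absolutelyContinuous_of_le (Measure.le_add_left le_rfl)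
  · rw [← withDensity_add_measure, hfc]
  · rw [← withDensity_add_measure, hgd]

end Splitting

/-! ### Gluing and composition of plans -/

section Coupling

variable {α β γ : Type*} [MeasurableSpace α] [MeasurableSpace β] [MeasurableSpace γ]

theorem isFiniteMeasure_of_fst {q : Measure (α × β)} [h : IsFiniteMeasure q.fst] :
    IsFiniteMeasure q :=
  ⟨by rw [← Measure.fst_univ]; exact h.measure_univ_lt_top⟩

theorem isFiniteMeasure_of_snd {q : Measure (α × β)} [h : IsFiniteMeasure q.snd] :
    IsFiniteMeasure q :=
  ⟨by rw [← Measure.snd_univ]; exact h.measure_univ_lt_top⟩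

theorem isFiniteMeasure_left {a b c : Measure α} [IsFiniteMeasure c] (h : c = a + b) :
    IsFiniteMeasure a :=
  isFiniteMeasure_of_le c (h ▸ Measure.le_add_right le_rfl)

theorem isFiniteMeasure_right {a b c : Measure α} [IsFiniteMeasure c] (h : c = a + b) :
    IsFiniteMeasure b :=
  isFiniteMeasure_of_le c (h ▸ Measure.le_add_left le_rfl)

open ProbabilityTheory in
/-- Gluing of two transport plans along their common marginal. -/
theorem exists_gluing [StandardBorelSpace γ] [Nonempty γ] {q₁ : Measure (α × β)}
    {q₂ : Measure (β × γ)} [IsFiniteMeasure q₁] [IsFiniteMeasure q₂] (h : q₁.snd = q₂.fst) :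
    ∃ T : Measure ((α × β) × γ), T.map Prod.fst = q₁ ∧
      T.map (fun z => (z.1.2, z.2)) = q₂ := by
  let κ : Kernel β γ := q₂.condKernel
  let κ' : Kernel (α × β) γ := κ.comap Prod.snd measurable_snd
  -- Given the middle point, the end point is drawn from the disintegration of `q₂`, independently
  -- of the starting point.
  refine ⟨q₁ ⊗ₘ κ', ?_, ?_⟩
  · exact Measure.fst_compProd q₁ κ'
  · have hm : Measurable fun z : (α × β) × γ => (z.1.2, z.2) := by fun_prop
    conv_rhs => rw [← q₂.disintegrate q₂.condKernel, ← h]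
    ext s hs
    rw [Measure.map_apply hm hs, Measure.compProd_apply (hm hs), Measure.compProd_apply hs,
      Measure.snd, lintegral_map (Kernel.measurable_kernel_prodMk_left hs) measurable_snd]
    rfl

/-- Composition of two transport plans for costs that satisfy the triangle inequality through
almost every point of the intermediate measure. -/
theorem exists_composition [StandardBorelSpace γ] [Nonempty γ] {q₁ : Measure (α × β)}
    {q₂ : Measure (β × γ)} [IsFiniteMeasure q₁] [IsFiniteMeasure q₂] (h : q₁.snd = q₂.fst)
    {c : α × γ → ℝ≥0∞} {c₁ : α × β → ℝ≥0∞} {c₂ : β × γ → ℝ≥0∞} (hc₁ : Measurable c₁)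
    (hc₂ : Measurable c₂)
    (htri : ∀ᵐ y ∂q₁.snd, ∀ x z, c (x, z) ≤ c₁ (x, y) + c₂ (y, z)) :
    ∃ q : Measure (α × γ), q.fst = q₁.fst ∧ q.snd = q₂.snd ∧
      ∫⁻ z, c z ∂q ≤ ∫⁻ z, c₁ z ∂q₁ + ∫⁻ z, c₂ z ∂q₂ := by
  obtain ⟨T, hT₁, hT₂⟩ := exists_gluing h
  have hm : Measurable fun z : (α × β) × γ => (z.1.2, z.2) := by fun_prop
  refine ⟨T.map fun z => (z.1.1, z.2), ?_, ?_, ?_⟩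
  · rw [← hT₁, Measure.fst, Measure.fst, Measure.map_map (by fun_prop) (by fun_prop),
      Measure.map_map (by fun_prop) (by fun_prop)]
    rfl
  · rw [← hT₂, Measure.snd, Measure.snd, Measure.map_map (by fun_prop) (by fun_prop),
      Measure.map_map (by fun_prop) (by fun_prop)]
    rfl
  · refine (lintegral_map_le _ _).trans ?_
    conv_rhs => rw [← hT₁, ← hT₂]
    rw [lintegral_map hc₁ measurable_fst, lintegral_map hc₂ hm,
      ← lintegral_add_left (show Measurable fun z : (α × β) × γ => c₁ z.1 from
        hc₁.comp measurable_fst)]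
    refine lintegral_mono_ae ?_
    have h1 : q₁.snd = T.map (fun z => z.1.2) := by
      rw [← hT₁, Measure.snd, Measure.map_map (by fun_prop) (by fun_prop)]
      rfl
    rw [h1] at htri
    filter_upwards [ae_of_ae_map (by fun_prop) htri] with z hz
    exact hz _ _

/-- Integrals against small parts of a measure are small. -/
theorem tendsto_lintegral_of_le {a : Measure α} {e : α → ℝ≥0∞} (he : Measurable e)
    (hfin : ∫⁻ x, e x ∂a ≠ ∞) {b : ℕ → Measure α} (hb : ∀ n, b n ≤ a)
    (hb0 : Tendsto (fun n => b n univ) atTop (𝓝 0)) :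
    Tendsto (fun n => ∫⁻ x, e x ∂b n) atTop (𝓝 0) := by
  -- Truncation: `e ≤ k + (e - k)`. The excess over a high level `k` is small already against `a`,
  -- and the level itself contributes at most `k` times a vanishing mass.
  have h1 : Tendsto (fun k : ℕ => ∫⁻ x, (e x - k) ∂a) atTop (𝓝 0) := by
    rw [← lintegral_zero (μ := a)]
    refine tendsto_lintegral_of_dominated_convergence e (fun k => by fun_prop)
      (fun k => ae_of_all _ fun x => tsub_le_self) hfin ?_
    filter_upwards [ae_lt_top he hfin] with x hx
    obtain ⟨k, hk⟩ := ENNReal.exists_nat_gt hx.ne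
    refine tendsto_const_nhds.congr' ?_
    filter_upwards [eventually_ge_atTop k] with n hn
    exact (tsub_eq_zero_of_le (hk.le.trans (by exact_mod_cast hn))).symm
  rw [ENNReal.tendsto_nhds_zero] at h1 hb0 ⊢
  intro ε hε
  rcases eq_or_ne ε ∞ with rfl | hεt
  · simp
  have hε2 : 0 < ε / 2 := ENNReal.half_pos hε.ne'
  obtain ⟨k, hk⟩ := (h1 (ε / 2) hε2).exists
  have hk0 : (0 : ℝ≥0∞) < ε / 2 / (k + 1) := ENNReal.div_pos hε2.ne' (by finiteness)
  filter_upwards [hb0 _ hk0] with n hn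
  calc ∫⁻ x, e x ∂b n ≤ ∫⁻ x, (k + (e x - k)) ∂b n :=
        lintegral_mono fun x => le_add_tsub
    _ = k * b n univ + ∫⁻ x, (e x - k) ∂b n := by
        rw [lintegral_add_left measurable_const, lintegral_const]
    _ ≤ (k + 1) * (ε / 2 / (k + 1)) + ε / 2 := by
        gcongr
        · simp
        · exact (lintegral_mono' (hb n) le_rfl).trans hk
    _ = ε := by
        rw [ENNReal.mul_div_cancel (by simp) (by finiteness), ENNReal.add_halves]

end Coupling

/-! ### Cancelling a common part of the marginals -/

section Cancellation

variable {α : Type*} [MeasurableSpace α]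

theorem lintegral_fst {β : Type*} [MeasurableSpace β] {q : Measure (α × β)} {e : α → ℝ≥0∞}
    (he : Measurable e) : ∫⁻ x, e x ∂q.fst = ∫⁻ z, e z.1 ∂q :=
  lintegral_map he measurable_fst

theorem lintegral_snd {β : Type*} [MeasurableSpace β] {q : Measure (β × α)} {e : α → ℝ≥0∞}
    (he : Measurable e) : ∫⁻ x, e x ∂q.snd = ∫⁻ z, e z.2 ∂q :=
  lintegral_map he measurable_snd

theorem lintegral_fst_add_snd {q : Measure (α × α)} {e : α → ℝ≥0∞} (he : Measurable e) :
    ∫⁻ x, e x ∂q.fst + ∫⁻ x, e x ∂q.snd = ∫⁻ z, (e z.1 + e z.2) ∂q := by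
  rw [lintegral_fst he, lintegral_snd he, lintegral_add_left (by fun_prop)]

theorem transportCost_one_le {c : α → α → ℝ≥0∞} {q : Measure (α × α)} :
    transportCost c 1 q.fst q.snd ≤ ∫⁻ z, c z.1 z.2 ∂q := by
  refine (iInf_le_of_le q (iInf_le_of_le rfl (iInf_le _ rfl))).trans_eq ?_
  simp

/-- Coupling two measures of equal mass by their normalised product. -/
theorem exists_coupling_of_mass_eq {a b : Measure α} [IsFiniteMeasure a] [IsFiniteMeasure b]
    (h : a univ = b univ) {c : α → α → ℝ≥0∞} {e : α → ℝ≥0∞} (he : Measurable e)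
    (hc : ∀ x y, c x y ≤ e x + e y) :
    ∃ q : Measure (α × α), q.fst = a ∧ q.snd = b ∧
      ∫⁻ z, c z.1 z.2 ∂q ≤ ∫⁻ x, e x ∂a + ∫⁻ x, e x ∂b := by
  rcases eq_or_ne (a univ) 0 with h0 | h0
  · have ha : a = 0 := Measure.measure_univ_eq_zero.1 h0
    have hb : b = 0 := Measure.measure_univ_eq_zero.1 (h ▸ h0)
    exact ⟨0, by simp [ha], by simp [hb], by simp⟩
  have hfst : ((a univ)⁻¹ • a.prod b).fst = a := by
    rw [Measure.fst, Measure.map_smul, Measure.map_fst_prod, smul_smul, ← h,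
      ENNReal.inv_mul_cancel h0 (measure_ne_top _ _), one_smul]
  have hsnd : ((a univ)⁻¹ • a.prod b).snd = b := by
    rw [Measure.snd, Measure.map_smul, Measure.map_snd_prod, smul_smul,
      ENNReal.inv_mul_cancel h0 (measure_ne_top _ _), one_smul]
  refine ⟨(a univ)⁻¹ • a.prod b, hfst, hsnd, ?_⟩
  have := lintegral_fst_add_snd (q := (a univ)⁻¹ • a.prod b) he
  rw [hfst, hsnd] at this
  rw [this]
  exact lintegral_mono fun z => hc _ _

/-- The part of the plan that arrives in `r` is glued to the part of the next copy of `q` that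
departs from `r`. Chaining `n + 1` copies of `q` thus uses `r` only once, while the cost grows
linearly; after division by `n + 1` the share of `r` is negligible. -/
theorem exists_iterated_plan [StandardBorelSpace α] [Nonempty α] {c : α → α → ℝ≥0∞}
    (hc : Measurable (Function.uncurry c)) {a b r : Measure α} [IsFiniteMeasure a]
    [IsFiniteMeasure b] [IsFiniteMeasure r] (htri : ∀ᵐ y ∂r, ∀ x z, c x z ≤ c x y + c y z)
    {q : Measure (α × α)} (hq₁ : q.fst = a + r) (hq₂ : q.snd = b + r) (n : ℕ) :
    ∃ Q : Measure (α × α), Q.fst = (n + 1) • a + r ∧ Q.snd = (n + 1) • b + r ∧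
      ∫⁻ z, c z.1 z.2 ∂Q ≤ (n + 1) • ∫⁻ z, c z.1 z.2 ∂q := by
  induction n with
  | zero => exact ⟨q, by simpa using hq₁, by simpa using hq₂, by simp⟩
  | succ n ih =>
    obtain ⟨Q, hQ₁, hQ₂, hQ⟩ := ih
    obtain ⟨Q₁, Q₂, rfl, hQb, hQr⟩ := exists_add_of_map_eq_add measurable_snd hQ₂
    obtain ⟨q₁, q₂, rfl, hqa, hqr⟩ := exists_add_of_map_eq_add measurable_fst hq₁
    change Q₁.snd = _ at hQb
    change Q₂.snd = _ at hQr
    change q₁.fst = _ at hqa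
    change q₂.fst = _ at hqr
    have : IsFiniteMeasure Q₂ := have : IsFiniteMeasure Q₂.snd := hQr ▸ ‹_›; isFiniteMeasure_of_snd
    have : IsFiniteMeasure q₂ := have : IsFiniteMeasure q₂.fst := hqr ▸ ‹_›; isFiniteMeasure_of_fst
    obtain ⟨g, hg₁, hg₂, hg⟩ := exists_composition (q₁ := Q₂) (q₂ := q₂) (hQr.trans hqr.symm)
      (c := fun z => c z.1 z.2) (c₁ := fun z => c z.1 z.2) (c₂ := fun z => c z.1 z.2) hc hc
      (hQr ▸ htri)
    refine ⟨Q₁ + g + q₁, ?_, ?_, ?_⟩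
    · rw [Measure.fst_add] at hQ₁
      rw [Measure.fst_add, Measure.fst_add, hg₁, hQ₁, hqa, succ_nsmul _ (n + 1)]
      abel
    · rw [Measure.snd_add] at hq₂
      rw [Measure.snd_add, Measure.snd_add, hg₂, hQb, add_assoc, add_comm q₂.snd, hq₂,
        succ_nsmul _ (n + 1), add_assoc]
    · rw [lintegral_add_measure] at hQ
      rw [lintegral_add_measure, lintegral_add_measure, lintegral_add_measure,
        succ_nsmul _ (n + 1)]
      calc _ ≤ ∫⁻ z, c z.1 z.2 ∂Q₁ + (∫⁻ z, c z.1 z.2 ∂Q₂ + ∫⁻ z, c z.1 z.2 ∂q₂)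
              + ∫⁻ z, c z.1 z.2 ∂q₁ := by gcongr
        _ = (∫⁻ z, c z.1 z.2 ∂Q₁ + ∫⁻ z, c z.1 z.2 ∂Q₂)
              + (∫⁻ z, c z.1 z.2 ∂q₁ + ∫⁻ z, c z.1 z.2 ∂q₂) := by ring
        _ ≤ _ := by
          rw [lintegral_add_measure] at hQ
          gcongr

/-- A common part of the marginals can be cancelled if the cost satisfies the triangle inequality
through its points. -/
theorem transportCost_le_of_cancel [StandardBorelSpace α] [Nonempty α] {c : α → α → ℝ≥0∞}
    (hc : Measurable (Function.uncurry c)) {a b r : Measure α} [IsFiniteMeasure a]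
    [IsFiniteMeasure b] [IsFiniteMeasure r] (htri : ∀ᵐ y ∂r, ∀ x z, c x z ≤ c x y + c y z)
    {e : α → ℝ≥0∞} (he : Measurable e) (hce : ∀ x y, c x y ≤ e x + e y)
    (hea : ∫⁻ x, e x ∂a ≠ ∞) (heb : ∫⁻ x, e x ∂b ≠ ∞)
    {q : Measure (α × α)} (hq₁ : q.fst = a + r) (hq₂ : q.snd = b + r) :
    transportCost c 1 a b ≤ ∫⁻ z, c z.1 z.2 ∂q := by
  -- The iterated plan divided by `n + 1` is a plan of `a` to `b` except for mass that ends or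
  -- starts in `r`. This exceptional part is recoupled at a cost bounded through `e`, with errors
  -- `a'` and `b'` of mass at most `r univ / (n + 1)`.
  have step : ∀ n : ℕ, ∃ a' b' : Measure α, a' ≤ a ∧ b' ≤ b ∧
      a' univ ≤ r univ * (n + 1 : ℝ≥0∞)⁻¹ ∧ b' univ ≤ r univ * (n + 1 : ℝ≥0∞)⁻¹ ∧
      transportCost c 1 a b ≤ ∫⁻ z, c z.1 z.2 ∂q + (∫⁻ x, e x ∂a' + ∫⁻ x, e x ∂b') := by
    intro n
    obtain ⟨Q, hQ₁, hQ₂, hQ⟩ := exists_iterated_plan hc htri hq₁ hq₂ n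
    obtain ⟨Q₁, Q₂, rfl, hQa, hQr⟩ := exists_add_of_map_eq_add measurable_fst hQ₁
    change Q₁.fst = _ at hQa
    change Q₂.fst = _ at hQr
    rw [Measure.snd_add] at hQ₂
    obtain ⟨u₁, u₂, v₁, v₂, hu, hv, hub, hur⟩ := exists_refinement hQ₂
    have hbf : IsFiniteMeasure ((n + 1) • b) := inferInstance
    have := isFiniteMeasure_left hub
    have := isFiniteMeasure_right hub
    have := isFiniteMeasure_left hur
    have := isFiniteMeasure_right hur
    obtain ⟨P₁, P₂, rfl, hP₁, hP₂⟩ := exists_add_of_map_eq_add measurable_snd hu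
    change P₁.snd = _ at hP₁
    change P₂.snd = _ at hP₂
    rw [Measure.fst_add] at hQa
    have : IsFiniteMeasure P₁ := have : IsFiniteMeasure P₁.snd := hP₁ ▸ ‹_›; isFiniteMeasure_of_snd
    have : IsFiniteMeasure P₂ := have : IsFiniteMeasure P₂.snd := hP₂ ▸ ‹_›; isFiniteMeasure_of_snd
    -- `P₂` takes mass of `(n + 1) • a` into `r`, and `v₁` is the mass of `(n + 1) • b` that comes
    -- from `r`. They have equal mass, because `r` is filled and emptied equally, so `P₂.fst` can be
    -- coupled with `v₁`.
    have hr1 : P₂.fst univ = u₂ univ := by rw [← hP₂, Measure.fst_univ, Measure.snd_univ]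
    have hr2 : v₁ univ = u₂ univ := by
      have h1 : r univ = v₁ univ + v₂ univ := by
        rw [← hQr, Measure.fst_univ, ← Measure.snd_univ, hv]; rfl
      have h2 : r univ = u₂ univ + v₂ univ := by rw [hur]; rfl
      rw [h1] at h2
      exact (ENNReal.add_left_inj (measure_ne_top _ _)).1 h2
    have hur' : u₂ univ ≤ r univ := by rw [hur]; simp
    obtain ⟨g, hg₁, hg₂, hg⟩ :=
      exists_coupling_of_mass_eq (a := P₂.fst) (b := v₁) (hr1.trans hr2.symm) he hce
    set N : ℝ≥0∞ := (n + 1 : ℝ≥0∞) with hN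
    have hN0 : N ≠ 0 := by simp [hN]
    have hNt : N ≠ ∞ := by finiteness
    have hNs : ∀ m : Measure α, N⁻¹ • ((n + 1) • m) = m := by
      intro m
      rw [← Nat.cast_smul_eq_nsmul ℝ≥0∞, smul_smul]
      push_cast
      rw [ENNReal.inv_mul_cancel hN0 hNt, one_smul]
    refine ⟨N⁻¹ • P₂.fst, N⁻¹ • v₁, ?_, ?_, ?_, ?_, ?_⟩
    · rw [← hNs a, ← hQa]
      gcongr
      exact Measure.le_add_left le_rfl
    · rw [← hNs b, hub]
      gcongr
      exact Measure.le_add_left le_rfl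
    · rw [Measure.smul_apply, smul_eq_mul, mul_comm, hr1]
      gcongr
    · rw [Measure.smul_apply, smul_eq_mul, mul_comm, hr2]
      gcongr
    · have h1 : (N⁻¹ • (P₁ + g)).fst = a := by
        rw [Measure.fst, Measure.map_smul, ← Measure.fst, Measure.fst_add, hg₁, hQa, hNs]
      have h2 : (N⁻¹ • (P₁ + g)).snd = b := by
        rw [Measure.snd, Measure.map_smul, ← Measure.snd, Measure.snd_add, hg₂, hP₁, ← hub, hNs]
      have h3 := transportCost_one_le (c := c) (q := N⁻¹ • (P₁ + g))
      rw [h1, h2] at h3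
      refine h3.trans ?_
      rw [lintegral_smul_measure, lintegral_smul_measure, lintegral_smul_measure,
        lintegral_add_measure, smul_eq_mul, smul_eq_mul, smul_eq_mul, mul_add, ← mul_add]
      have h4 : ∫⁻ z, c z.1 z.2 ∂P₁ ≤ N * ∫⁻ z, c z.1 z.2 ∂q := by
        calc _ ≤ ∫⁻ z, c z.1 z.2 ∂(P₁ + P₂ + Q₂) := by
              refine lintegral_mono' ?_ le_rfl
              rw [add_assoc]
              exact Measure.le_add_right le_rfl
          _ ≤ _ := hQ
          _ = _ := by rw [nsmul_eq_mul]; push_cast; rfl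
      calc N⁻¹ * (∫⁻ z, c z.1 z.2 ∂P₁ + ∫⁻ z, c z.1 z.2 ∂g)
          ≤ N⁻¹ * (N * ∫⁻ z, c z.1 z.2 ∂q + (∫⁻ x, e x ∂P₂.fst + ∫⁻ x, e x ∂v₁)) := by
            gcongr
        _ = _ := by
            rw [mul_add, ← mul_assoc, ENNReal.inv_mul_cancel hN0 hNt, one_mul, mul_add]
  choose a' b' ha' hb' ha0 hb0 h using step
  have hlim : Tendsto (fun n : ℕ => r univ * (n + 1 : ℝ≥0∞)⁻¹) atTop (𝓝 0) := by
    rw [← mul_zero (r univ)]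
    refine ENNReal.Tendsto.const_mul ?_ (Or.inr (measure_ne_top _ _))
    have := (tendsto_add_atTop_iff_nat 1).2 ENNReal.tendsto_inv_nat_nhds_zero
    simpa using this
  have hA := tendsto_lintegral_of_le he hea ha'
    (tendsto_of_tendsto_of_tendsto_of_le_of_le tendsto_const_nhds hlim (fun _ => zero_le) ha0)
  have hB := tendsto_lintegral_of_le he heb hb'
    (tendsto_of_tendsto_of_tendsto_of_le_of_le tendsto_const_nhds hlim (fun _ => zero_le) hb0)
  have := (tendsto_const_nhds (x := ∫⁻ z, c z.1 z.2 ∂q)).add (hA.add hB)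
  rw [add_zero, add_zero] at this
  exact ge_of_tendsto' this h

end Cancellation

/-! ### The costs `d*` and `d'(·,∂)` -/

section Costs

variable {X : Type*} [MetricSpace X] {Y : Set X}

theorem continuous_dBdry : Continuous (dBdry Y) :=
  Metric.continuous_infEDist

theorem dBdry_ne_top (hY : Y ≠ univ) (x : X) : dBdry Y x ≠ ∞ :=
  Metric.infEDist_ne_top (nonempty_compl.2 hY)

theorem dBdry_le_edist_add (x y : X) : dBdry Y x ≤ edist x y + dBdry Y y :=
  Metric.infEDist_le_edist_add_infEDist

theorem dBdry_pos (hYo : IsOpen Y) {x : X} (hx : x ∈ Y) : 0 < dBdry Y x :=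
  pos_iff_ne_zero.2 fun h => (Metric.mem_iff_infEDist_zero_of_closed hYo.isClosed_compl).2 h hx

theorem dStar_comm (x y : X) : dStar Y x y = dStar Y y x := by
  unfold dStar
  refine iInf_congr fun z => iInf_congr fun _ => ?_
  rw [edist_comm x z, edist_comm z y, add_comm]

/-- A detour through one common point of `X \ Y` is no shorter than two optimal trips to `X \ Y`
taken separately. -/
theorem dBdry_add_le_dStar (x y : X) : dBdry Y x + dBdry Y y ≤ dStar Y x y := by
  refine le_iInf₂ fun z hz => ?_
  rw [edist_comm z y]
  exact add_le_add (iInf₂_le z hz) (iInf₂_le z hz)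

theorem dStar_self (x : X) : dStar Y x x = 2 * dBdry Y x := by
  unfold dStar dBdry
  rw [ENNReal.mul_iInf_of_ne (by simp) (by simp)]
  refine iInf_congr fun z => ?_
  rw [ENNReal.mul_iInf_of_ne (by simp) (by simp)]
  refine iInf_congr fun _ => ?_
  rw [edist_comm z x, two_mul]

theorem dStar_ne_top (hY : Y ≠ univ) (x y : X) : dStar Y x y ≠ ∞ := by
  obtain ⟨z, hz⟩ := nonempty_compl.2 hY
  exact ((iInf₂_le z hz).trans_lt (by finiteness)).ne

/-- An infimum of continuous functions. This yields measurability of `d*`. -/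
theorem upperSemicontinuous_dStar : UpperSemicontinuous fun z : X × X => dStar Y z.1 z.2 :=
  upperSemicontinuous_biInf fun w _ => Continuous.upperSemicontinuous (by fun_prop)

theorem upperSemicontinuous_dStar_left (y : X) : UpperSemicontinuous fun x : X => dStar Y x y :=
  upperSemicontinuous_biInf fun w _ => Continuous.upperSemicontinuous (by fun_prop)

variable [MeasurableSpace X] [BorelSpace X]

theorem measurable_dBdry : Measurable (dBdry Y) := continuous_dBdry.measurable

variable [SecondCountableTopology X]

theorem measurable_dStar : Measurable fun z : X × X => dStar Y z.1 z.2 :=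
  upperSemicontinuous_dStar.measurable

theorem measurable_edist_prod : Measurable fun z : X × X => edist z.1 z.2 := by fun_prop

end Costs

section TransportCost

variable {α : Type*} [MeasurableSpace α] {c : α → α → ℝ≥0∞} {p : ℝ} {μ ν : Measure α}

theorem transportCost_eq_iInf : transportCost c p μ ν =
    ⨅ q : {q : Measure (α × α) // q.fst = μ ∧ q.snd = ν}, ∫⁻ z, c z.1 z.2 ^ p ∂q.1 := by
  rw [iInf_subtype]
  simp_rw [iInf_and]
  rfl

theorem transportCost_le_lintegral {q : Measure (α × α)} (h₁ : q.fst = μ) (h₂ : q.snd = ν) :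
    transportCost c p μ ν ≤ ∫⁻ z, c z.1 z.2 ^ p ∂q :=
  iInf_le_of_le q (iInf_le_of_le h₁ (iInf_le _ h₂))

theorem transportDist_rpow (hp : 1 ≤ p) : transportDist c p μ ν ^ p = transportCost c p μ ν := by
  rw [transportDist, ← ENNReal.rpow_mul, one_div_mul_cancel (by linarith), ENNReal.rpow_one]

theorem transportDist_one : transportDist c 1 μ ν = transportCost c 1 μ ν := by
  simpa using transportDist_rpow (c := c) (μ := μ) (ν := ν) le_rfl

theorem measure_univ_eq_of_coupling {q : Measure (α × α)} (h₁ : q.fst = μ) (h₂ : q.snd = ν) :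
    μ univ = ν univ := by
  rw [← h₁, ← h₂, Measure.fst_univ, Measure.snd_univ]

/-- The diagonal coupling of a measure with itself. -/
theorem fst_map_diag (μ : Measure α) : (μ.map fun x => (x, x)).fst = μ := by
  rw [Measure.fst_map_prodMk measurable_id', Measure.map_id']

theorem snd_map_diag (μ : Measure α) : (μ.map fun x => (x, x)).snd = μ := by
  rw [Measure.snd_map_prodMk measurable_id', Measure.map_id']

theorem lintegral_map_diag_le (μ : Measure α) (f : α × α → ℝ≥0∞) :
    ∫⁻ z, f z ∂(μ.map fun x => (x, x)) ≤ ∫⁻ x, f (x, x) ∂μ :=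
  lintegral_map_le _ _

end TransportCost

/-! ### Annihilation cost and finite first moments -/

section Annihilation

variable {X : Type*} [MetricSpace X] [MeasurableSpace X] {Y : Set X}

theorem annihilationCost_rpow {p : ℝ} (hp : 1 ≤ p) (μ : Measure X) :
    annihilationCost p Y μ ^ p = transportCost (dStar Y) p μ μ * (2⁻¹ : ℝ≥0∞) ^ p := by
  rw [annihilationCost, div_eq_mul_inv, ENNReal.mul_rpow_of_nonneg _ _ (by linarith), WStar,
    transportDist_rpow hp]

variable [BorelSpace X]

/-- For `p = 1` the diagonal plan is optimal: `d*(x,x) = 2 d'(x,∂)`, and every plan costs at least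
the integral of `d'(x,∂) + d'(y,∂)`, which depends on the marginals only. -/
theorem annihilationCost_one (μ : Measure X) : annihilationCost 1 Y μ = ∫⁻ x, dBdry Y x ∂μ := by
  have h : WStar 1 Y μ μ = 2 * ∫⁻ x, dBdry Y x ∂μ := by
    rw [WStar, transportDist_one]
    apply le_antisymm
    · refine (transportCost_le_lintegral (fst_map_diag μ) (snd_map_diag μ)).trans ?_
      refine (lintegral_map_diag_le _ _).trans_eq ?_
      simp_rw [dStar_self, ENNReal.rpow_one]
      exact lintegral_const_mul _ measurable_dBdry
    · refine le_iInf fun q => le_iInf fun h₁ => le_iInf fun h₂ => ?_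
      calc 2 * ∫⁻ x, dBdry Y x ∂μ = ∫⁻ x, dBdry Y x ∂q.fst + ∫⁻ x, dBdry Y x ∂q.snd := by
            rw [h₁, h₂, two_mul]
        _ = ∫⁻ z, (dBdry Y z.1 + dBdry Y z.2) ∂q := lintegral_fst_add_snd measurable_dBdry
        _ ≤ _ := lintegral_mono fun z => by
          rw [ENNReal.rpow_one]
          exact dBdry_add_le_dStar _ _
  rw [annihilationCost, h, mul_comm, ENNReal.mul_div_cancel_right (by simp) (by simp)]

/-- A Dirac measure already has mass one, so `τ⁻ = 0` and no particle can become an antiparticle.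
Hence `q⁺⁺` carries all of `σ⁺ ≥ μ` to `o`, and its finite cost is the first moment. -/
theorem IsSubprobP.exists_lintegral_edist_lt [SecondCountableTopology X] {μ : Measure X}
    (h : IsSubprobP 1 Y μ) : ∃ o ∈ Y, ∫⁻ x, edist x o ∂μ < ∞ := by
  obtain ⟨-, o, ho, hW⟩ := h
  refine ⟨o, ho, ?_⟩
  simp only [WZero, WTilde, iInf_lt_iff, div_one, ENNReal.rpow_one] at hW
  obtain ⟨σ, τ, hσ, hτ, qpp, qpm, qmp, qmm, h1, h2, h3, h4, hW⟩ := hW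
  have hneg : τ.neg = 0 := by
    have := τ.mass_eq
    rw [hτ, Measure.add_apply, measure_univ, add_assoc] at this
    have h0 : τ.neg univ + τ.neg univ = 0 :=
      (ENNReal.add_right_inj ENNReal.one_ne_top).1 (this.trans (add_zero 1).symm)
    exact Measure.measure_univ_eq_zero.1 (add_eq_zero.1 h0).1
  rw [hneg, add_zero] at hτ
  have hqpm : qpm.fst univ = 0 := by
    rw [Measure.fst_univ, ← Measure.snd_univ]
    rw [hneg] at h4
    have := congrArg (fun m => m univ) h4
    exact (add_eq_zero.1 this).1
  rw [Measure.measure_univ_eq_zero.1 hqpm, add_zero] at h1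
  have hae : ∀ᵐ z ∂qpp, z.2 = o := by
    have : ∀ᵐ y ∂qpp.snd, y = o := by
      have hle : qpp.snd ≤ Measure.dirac o := by
        rw [← hτ, ← h3]
        exact Measure.le_add_right le_rfl
      exact (Measure.absolutelyContinuous_of_le hle).ae_le
        ((ae_dirac_iff (measurableSet_singleton o)).2 rfl)
    exact ae_of_ae_map measurable_snd.aemeasurable this
  calc ∫⁻ x, edist x o ∂μ ≤ ∫⁻ x, edist x o ∂qpp.fst := by
        refine lintegral_mono' ?_ le_rfl
        rw [h1, hσ]
        exact Measure.le_add_right le_rfl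
    _ = ∫⁻ z, edist z.1 o ∂qpp := lintegral_fst (by fun_prop)
    _ = ∫⁻ z, edist z.1 z.2 ∂qpp := lintegral_congr_ae (by
        filter_upwards [hae] with z hz
        rw [hz])
    _ < ∞ := lt_of_le_of_lt (by
        rw [add_assoc, add_assoc]
        exact le_self_add) hW

end Annihilation

/-! ### Approximate midpoints and annihilation plans -/

section Midpoints

variable {X : Type*} [MetricSpace X] {Y : Set X}

/-- Since `z` is at least as far from `x` as from `y`, the middle of a path from `x` through `z` to
`y` lies between `x` and `z`, so the second half of the path still passes through `z`. -/
theorem exists_midpoint_of_le (hX : IsLengthSpace X) {x y z : X} (hz : z ∈ Yᶜ) {c : ℝ≥0∞}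
    (hle : edist z y ≤ edist x z) (hc : (edist x z + edist z y) / 2 < c) :
    ∃ m, edist x m < c ∧ dStar Y m y < c := by
  set h : ℝ≥0∞ := (edist x z + edist z y) / 2 with hh
  have hht : h ≠ ∞ := hc.ne_top
  have hsum : edist x z + edist z y = h + h := (ENNReal.add_halves _).symm
  have hlt : edist x z < edist x z + (c - h) :=
    ENNReal.lt_add_right (by finiteness) (tsub_pos_of_lt hc).ne'
  conv_lhs at hlt => rw [hX x z]
  obtain ⟨γ, hγ⟩ := iInf_lt_iff.1 hlt
  have hcont : Continuous fun t : unitInterval => edist x (γ t) := by fun_prop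
  -- Intermediate values: the distance from `x` runs from `0` to `edist x z ≥ h` along `γ`.
  have hmem : h ∈ range fun t : unitInterval => edist x (γ t) := by
    refine mem_range_of_exists_le_of_exists_ge hcont ⟨0, by simp⟩ ⟨1, ?_⟩
    rw [γ.target]
    refine ENNReal.div_le_of_le_mul ?_
    rw [mul_two]
    gcongr
  obtain ⟨t, ht⟩ := hmem
  have hV : edist x (γ t) + edist (γ t) z ≤ eVariationOn (fun t : unitInterval => γ t) univ := by
    have h1 := eVariationOn.Icc_add_Icc (fun t : unitInterval => γ t) (s := univ)
      (a := 0) (b := t) (c := 1) unitInterval.nonneg' unitInterval.le_one' (mem_univ _)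
    refine (add_le_add ?_ ?_).trans (h1.trans_le (eVariationOn.mono _ (subset_univ _)))
    · have h2 : edist (γ 0) (γ t) ≤ _ :=
        eVariationOn.edist_le (fun t : unitInterval => γ t) (s := univ ∩ Icc 0 t)
          ⟨mem_univ _, left_mem_Icc.2 unitInterval.nonneg'⟩
        ⟨mem_univ _, right_mem_Icc.2 unitInterval.nonneg'⟩
      rwa [γ.source] at h2
    · have h2 : edist (γ t) (γ 1) ≤ _ :=
        eVariationOn.edist_le (fun t : unitInterval => γ t) (s := univ ∩ Icc t 1)
          ⟨mem_univ _, left_mem_Icc.2 unitInterval.le_one'⟩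
        ⟨mem_univ _, right_mem_Icc.2 unitInterval.le_one'⟩
      rwa [γ.target] at h2
  refine ⟨γ t, ht.trans_lt hc, (iInf₂_le z hz).trans_lt ?_⟩
  refine (ENNReal.add_lt_add_iff_left hht).1 ?_
  calc h + (edist (γ t) z + edist z y) = edist x (γ t) + edist (γ t) z + edist z y := by
        rw [← ht, add_assoc]
    _ < edist x z + (c - h) + edist z y :=
        ENNReal.add_lt_add_right (by finiteness) (hV.trans_lt hγ)
    _ = h + h + (c - h) := by rw [← hsum]; ring
    _ = h + c := by rw [add_assoc, add_tsub_cancel_of_le hc.le]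

theorem exists_midpoint (hX : IsLengthSpace X) {x y : X} {c : ℝ≥0∞} (hc : dStar Y x y / 2 < c) :
    ∃ m, (edist x m < c ∧ dStar Y m y < c) ∨ (edist y m < c ∧ dStar Y m x < c) := by
  have h2 : dStar Y x y < 2 * c := by
    rwa [mul_comm, ← ENNReal.div_lt_iff (by simp) (by simp)]
  simp only [dStar, iInf_lt_iff] at h2
  obtain ⟨z, hz, h2⟩ := h2
  rw [mul_comm, ← ENNReal.div_lt_iff (by simp) (by simp)] at h2
  rcases le_total (edist z y) (edist x z) with h | h
  · obtain ⟨m, hm⟩ := exists_midpoint_of_le hX hz h h2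
    exact ⟨m, Or.inl hm⟩
  · rw [add_comm, edist_comm x z, edist_comm z y] at h2
    obtain ⟨m, hm⟩ := exists_midpoint_of_le hX hz (by rwa [edist_comm z x, edist_comm y z]) h2
    exact ⟨m, Or.inr hm⟩

/-- The point `w` is an approximate midpoint of a curve from `x` to `y` through `X \ Y`, with the
factor `κ > 1/2`. -/
def IsApproxMidpoint (Y : Set X) (κ : ℝ≥0∞) (z : X × X) (w : X) : Prop :=
  (edist z.1 w < κ * dStar Y z.1 z.2 ∧ dStar Y w z.2 < κ * dStar Y z.1 z.2) ∨
    (edist z.2 w < κ * dStar Y z.1 z.2 ∧ dStar Y w z.1 < κ * dStar Y z.1 z.2)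

theorem isOpen_isApproxMidpoint (κ : ℝ≥0∞) (z : X × X) : IsOpen {w | IsApproxMidpoint Y κ z w} := by
  have h1 : ∀ a c, IsOpen {w : X | edist a w < c} := fun a c =>
    isOpen_lt (by fun_prop) continuous_const
  have h2 : ∀ a c, IsOpen {w : X | dStar Y w a < c} := fun a c =>
    (upperSemicontinuous_dStar_left a).isOpen_preimage c
  exact ((h1 _ _).inter (h2 _ _)).union ((h1 _ _).inter (h2 _ _))

theorem exists_denseSeq_isApproxMidpoint [TopologicalSpace.SeparableSpace X] [Nonempty X]
    (hX : IsLengthSpace X) (hY : Y ≠ univ) {κ : ℝ≥0∞} (hκ : 2⁻¹ < κ) {z : X × X}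
    (hz : 0 < dStar Y z.1 z.2) :
    ∃ k, IsApproxMidpoint Y κ z (TopologicalSpace.denseSeq X k) := by
  have hlt : dStar Y z.1 z.2 / 2 < κ * dStar Y z.1 z.2 := by
    rw [div_eq_mul_inv, mul_comm]
    exact ENNReal.mul_lt_mul_left hz.ne' (dStar_ne_top hY _ _) hκ
  exact (TopologicalSpace.denseRange_denseSeq X).exists_mem_open (isOpen_isApproxMidpoint κ z)
    (exists_midpoint hX hlt)

variable [MeasurableSpace X] [BorelSpace X] [SecondCountableTopology X]

-- The approximate midpoints of a pair form an open set, so the first suitable member of a dense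
-- sequence is a measurable choice. The condition `0 < d*` is needed because the defining
-- inequalities are strict.
open TopologicalSpace in
theorem exists_measurable_midpoint (hX : IsLengthSpace X) (hY : Y ≠ univ) {κ : ℝ≥0∞}
    (hκ : 2⁻¹ < κ) :
    ∃ m : X × X → X, Measurable m ∧
      ∀ z, 0 < dStar Y z.1 z.2 → IsApproxMidpoint Y κ z (m z) := by
  classical
  rcases isEmpty_or_nonempty X with hE | hE
  · exact ⟨Prod.fst, measurable_fst, fun z => isEmptyElim z.1⟩
  have hex : ∀ z : X × X, ∃ k : ℕ,
      IsApproxMidpoint Y κ z (denseSeq X k) ∨ ¬ 0 < dStar Y z.1 z.2 := by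
    intro z
    by_cases hz : 0 < dStar Y z.1 z.2
    · obtain ⟨k, hk⟩ := exists_denseSeq_isApproxMidpoint hX hY hκ hz
      exact ⟨k, Or.inl hk⟩
    · exact ⟨0, Or.inr hz⟩
  have hD : Measurable fun z : X × X => dStar Y z.1 z.2 := measurable_dStar
  have hw : ∀ w : X, Measurable fun y : X => dStar Y w y := fun w =>
    hD.comp (g := fun z : X × X => dStar Y z.1 z.2) (f := fun y => (w, y)) (by fun_prop)
  have hmeas : ∀ k : ℕ, MeasurableSet {z : X × X | IsApproxMidpoint Y κ z (denseSeq X k) ∨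
      ¬ 0 < dStar Y z.1 z.2} := by
    intro k
    have m₀ : Measurable fun z : X × X => κ * dStar Y z.1 z.2 := hD.const_mul κ
    have m₁ : MeasurableSet {z : X × X | edist z.1 (denseSeq X k) < κ * dStar Y z.1 z.2} :=
      measurableSet_lt (by fun_prop) m₀
    have m₂ : MeasurableSet {z : X × X | edist z.2 (denseSeq X k) < κ * dStar Y z.1 z.2} :=
      measurableSet_lt (by fun_prop) m₀
    have m₃ : MeasurableSet {z : X × X | dStar Y (denseSeq X k) z.2 < κ * dStar Y z.1 z.2} :=
      measurableSet_lt ((hw _).comp measurable_snd) m₀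
    have m₄ : MeasurableSet {z : X × X | dStar Y (denseSeq X k) z.1 < κ * dStar Y z.1 z.2} :=
      measurableSet_lt ((hw _).comp measurable_fst) m₀
    have m₅ : MeasurableSet {z : X × X | 0 < dStar Y z.1 z.2} :=
      measurableSet_lt measurable_const hD
    exact ((m₁.inter m₃).union (m₂.inter m₄)).union m₅.compl
  have hfind : Measurable fun z => Nat.find (hex z) := measurable_find hex hmeas
  refine ⟨fun z => denseSeq X (Nat.find (hex z)), measurable_from_nat.comp hfind,
    fun z hz => ?_⟩
  have := Nat.find_spec (hex z)
  exact this.resolve_right (not_not.2 hz)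

/-- Half of the mass moves to the approximate midpoints as particles, the other half as
antiparticles; there they annihilate. -/
theorem exists_annihilation_plan (hX : IsLengthSpace X) (hYo : IsOpen Y) (hY : Y ≠ univ)
    {κ : ℝ≥0∞} (hκ : 2⁻¹ < κ) {p : ℝ} (hp : 1 ≤ p) {μ : Measure X} (hμ : μ Yᶜ = 0)
    {q : Measure (X × X)} (hq₁ : q.fst = μ) (hq₂ : q.snd = μ) :
    ∃ u v : Measure (X × X), u.fst + v.fst = μ ∧ u.snd = v.snd ∧
      ∫⁻ z, edist z.1 z.2 ^ p ∂u + ∫⁻ z, dStar Y z.1 z.2 ^ p ∂v ≤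
        (∫⁻ z, dStar Y z.1 z.2 ^ p ∂q) * κ ^ p := by
  obtain ⟨m, hm, hmid⟩ := exists_measurable_midpoint hX hY hκ
  have hD : Measurable fun z : X × X => dStar Y z.1 z.2 := measurable_dStar
  -- A point of the open set `Y` has positive distance to `X \ Y`, and this bounds `d*` from below.
  have hpos : ∀ᵐ z ∂q, 0 < dStar Y z.1 z.2 := by
    have h1 : ∀ᵐ x ∂q.fst, x ∈ Y := by rw [hq₁]; exact hμ
    filter_upwards [ae_of_ae_map measurable_fst.aemeasurable h1] with z hz
    exact (dBdry_pos hYo hz).trans_le (le_self_add.trans (dBdry_add_le_dStar _ _))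
  -- On `A` the first point goes to the midpoint directly and the second one through `X \ Y`; off
  -- `A` the roles are exchanged.
  let A : Set (X × X) := {z | edist z.1 (m z) < κ * dStar Y z.1 z.2 ∧
    dStar Y (m z) z.2 < κ * dStar Y z.1 z.2}
  have hA : MeasurableSet A :=
    (measurableSet_lt (by fun_prop) (hD.const_mul κ)).inter
      (measurableSet_lt (hD.comp (hm.prodMk measurable_snd)) (hD.const_mul κ))
  let f₁ : X × X → X × X := fun z => (z.1, m z)
  let f₂ : X × X → X × X := fun z => (z.2, m z)
  have hf₁ : Measurable f₁ := measurable_fst.prodMk hm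
  have hf₂ : Measurable f₂ := measurable_snd.prodMk hm
  let q₁ := q.restrict A
  let q₂ := q.restrict Aᶜ
  have hq : q₁ + q₂ = q := Measure.restrict_add_restrict_compl hA
  have hfst₁ : ∀ r : Measure (X × X), (r.map f₁).fst = r.fst := fun r =>
    Measure.fst_map_prodMk hm
  have hfst₂ : ∀ r : Measure (X × X), (r.map f₂).fst = r.snd := fun r =>
    Measure.fst_map_prodMk hm
  have hsnd₁ : ∀ r : Measure (X × X), (r.map f₁).snd = r.map m := fun r =>
    Measure.snd_map_prodMk measurable_fst
  have hsnd₂ : ∀ r : Measure (X × X), (r.map f₂).snd = r.map m := fun r =>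
    Measure.snd_map_prodMk measurable_snd
  have fst_smul : ∀ r : Measure (X × X), ((2⁻¹ : ℝ≥0∞) • r).fst = (2⁻¹ : ℝ≥0∞) • r.fst :=
    fun r => Measure.map_smul ..
  have snd_smul : ∀ r : Measure (X × X), ((2⁻¹ : ℝ≥0∞) • r).snd = (2⁻¹ : ℝ≥0∞) • r.snd :=
    fun r => Measure.map_smul ..
  -- Both marginals of `q` are `μ`, so all departures together amount to `2μ`; the factor `1/2`
  -- corrects this. The plan `u` collects the direct journeys and `v` those through `X \ Y`.
  refine ⟨(2⁻¹ : ℝ≥0∞) • (q₁.map f₁ + q₂.map f₂), (2⁻¹ : ℝ≥0∞) • (q₁.map f₂ + q₂.map f₁),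
    ?_, ?_, ?_⟩
  · rw [fst_smul, fst_smul, ← smul_add, Measure.fst_add, Measure.fst_add, hfst₁, hfst₁, hfst₂,
      hfst₂]
    have : q₁.fst + q₂.snd + (q₁.snd + q₂.fst) = μ + μ := by
      calc _ = (q₁.fst + q₂.fst) + (q₁.snd + q₂.snd) := by abel
        _ = _ := by rw [← Measure.fst_add, ← Measure.snd_add, hq, hq₁, hq₂]
    rw [this, ← two_smul ℝ≥0∞ μ, smul_smul, ENNReal.inv_mul_cancel (by simp) (by simp), one_smul]
  · rw [snd_smul, snd_smul, Measure.snd_add, Measure.snd_add, hsnd₁, hsnd₁, hsnd₂, hsnd₂]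
  · have hp0 : 0 ≤ p := by linarith
    let J : Measure (X × X) → ℝ≥0∞ := fun r => ∫⁻ z, (κ * dStar Y z.1 z.2) ^ p ∂r
    have hJ : J q₁ + J q₂ = (∫⁻ z, dStar Y z.1 z.2 ^ p ∂q) * κ ^ p := by
      rw [← lintegral_add_measure, hq, mul_comm, ← lintegral_const_mul _ (hD.pow_const p)]
      simp_rw [ENNReal.mul_rpow_of_nonneg _ _ hp0]
    have bound : ∀ (r : Measure (X × X)) (g : X × X → ℝ≥0∞) (f : X × X → X × X),
        (∀ᵐ z ∂r, g (f z) ≤ κ * dStar Y z.1 z.2) → ∫⁻ z, g z ^ p ∂(r.map f) ≤ J r := by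
      intro r g f h
      refine (lintegral_map_le _ _).trans (lintegral_mono_ae ?_)
      filter_upwards [h] with z hz
      exact ENNReal.rpow_le_rpow hz hp0
    have hmA : ∀ᵐ z ∂q₁, z ∈ A := ae_restrict_mem hA
    have hmAc : ∀ᵐ z ∂q₂, edist z.2 (m z) < κ * dStar Y z.1 z.2 ∧
        dStar Y (m z) z.1 < κ * dStar Y z.1 z.2 := by
      filter_upwards [ae_restrict_mem hA.compl, ae_restrict_of_ae hpos] with z hz hz0
      exact (hmid z hz0).resolve_left hz
    have b₁ := bound q₁ (fun z => edist z.1 z.2) f₁ (hmA.mono fun z hz => hz.1.le)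
    have b₂ := bound q₂ (fun z => edist z.1 z.2) f₂ (hmAc.mono fun z hz => hz.1.le)
    have b₃ := bound q₁ (fun z => dStar Y z.1 z.2) f₂
      (hmA.mono fun z hz => (dStar_comm _ _).trans_le hz.2.le)
    have b₄ := bound q₂ (fun z => dStar Y z.1 z.2) f₁
      (hmAc.mono fun z hz => (dStar_comm _ _).trans_le hz.2.le)
    rw [lintegral_smul_measure, lintegral_smul_measure, lintegral_add_measure,
      lintegral_add_measure, ← smul_add, smul_eq_mul, ← hJ]
    calc _ ≤ 2⁻¹ * (J q₁ + J q₂ + (J q₁ + J q₂)) := by gcongr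
      _ = _ := by
        rw [← two_mul, ← mul_assoc, ENNReal.inv_mul_cancel (by simp) (by simp), one_mul]

end Midpoints

/-! ### Upper bounds for `W⁰_p` -/

section UpperBound

theorem lintegral_map_swap_le {α : Type*} [MeasurableSpace α] {f : α × α → ℝ≥0∞}
    (hf : ∀ x y, f (x, y) = f (y, x)) (u : Measure (α × α)) :
    ∫⁻ z, f z ∂(u.map Prod.swap) ≤ ∫⁻ z, f z ∂u :=
  (lintegral_map_le _ _).trans_eq (lintegral_congr fun _ => hf _ _)

variable {X : Type*} [MetricSpace X] {Y : Set X} [MeasurableSpace X]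

/-- The charged probability with effective measure `μ` and negative part `n`. -/
def chargedOfNeg (μ n : Measure X) (hμ : μ Yᶜ = 0) (hm : μ univ + (n univ + n univ) = 1) :
    ChargedProb Y where
  pos := μ + n
  neg := n
  restrict_eq := by rw [Measure.restrict_add, Measure.restrict_eq_zero.2 hμ, zero_add]
  mass_eq := by rw [Measure.add_apply, add_assoc, hm]

variable {p : ℝ} {μ ν : Measure X}

theorem wZero_rpow_le (hp : 1 ≤ p) {σ τ : ChargedProb Y} (hσ : σ.pos = μ + σ.neg)
    (hτ : τ.pos = ν + τ.neg) {qpp qpm qmp qmm : Measure (X × X)}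
    (h₁ : qpp.fst + qpm.fst = σ.pos) (h₂ : qmp.fst + qmm.fst = σ.neg)
    (h₃ : qpp.snd + qmp.snd = τ.pos) (h₄ : qpm.snd + qmm.snd = τ.neg) :
    WZero p Y μ ν ^ p ≤ (∫⁻ z, edist z.1 z.2 ^ p ∂qpp) + (∫⁻ z, dStar Y z.1 z.2 ^ p ∂qpm)
      + (∫⁻ z, dStar Y z.1 z.2 ^ p ∂qmp) + (∫⁻ z, edist z.1 z.2 ^ p ∂qmm) := by
  have hp0 : 0 < p := by linarith
  have h : WZero p Y μ ν ≤ WTilde p Y σ τ :=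
    iInf_le_of_le σ (iInf_le_of_le τ (iInf_le_of_le hσ (iInf_le _ hτ)))
  refine (ENNReal.rpow_le_rpow h hp0.le).trans ?_
  rw [WTilde, ← ENNReal.rpow_mul, one_div_mul_cancel hp0.ne', ENNReal.rpow_one]
  exact iInf_le_of_le qpp (iInf_le_of_le qpm (iInf_le_of_le qmp (iInf_le_of_le qmm
    (iInf_le_of_le h₁ (iInf_le_of_le h₂ (iInf_le_of_le h₃ (iInf_le _ h₄)))))))

theorem wZero_rpow_le_of_plans (hp : 1 ≤ p) {μ₁ μ₀ ν₁ ν₀ : Measure X}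
    (hμ : IsSubprob Y μ) (hν : IsSubprob Y ν) (hμ' : μ = μ₁ + μ₀) (hν' : ν = ν₁ + ν₀)
    (hm : (μ + ν₀) univ ≤ 1) {q u v u' v' : Measure (X × X)}
    (hq₁ : q.fst = μ₁) (hq₂ : q.snd = ν₁) (hu : u.fst + v.fst = μ₀) (huv : u.snd = v.snd)
    (hu' : u'.fst + v'.fst = ν₀) (huv' : u'.snd = v'.snd) (o : X) :
    WZero p Y μ ν ^ p ≤ (∫⁻ z, edist z.1 z.2 ^ p ∂q) +
      ((∫⁻ z, edist z.1 z.2 ^ p ∂u) + ∫⁻ z, dStar Y z.1 z.2 ^ p ∂v) +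
      ((∫⁻ z, edist z.1 z.2 ^ p ∂u') + ∫⁻ z, dStar Y z.1 z.2 ^ p ∂v') := by
  have half : ∀ {u v : Measure (X × X)} {m : Measure X}, u.fst + v.fst = m → u.snd = v.snd →
      u.snd univ + u.snd univ = m univ := by
    intro u v m h h'
    rw [← h, Measure.add_apply, Measure.fst_univ, Measure.fst_univ]
    conv_lhs => arg 2; rw [h']
    rw [Measure.snd_univ, Measure.snd_univ]
  -- Idle pairs of a particle and an antiparticle at `o` fill the total mass up to one.
  set r : Measure X := ((1 - (μ + ν₀) univ) * 2⁻¹) • Measure.dirac o with hr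
  have hr2 : r univ + r univ = 1 - (μ + ν₀) univ := by
    rw [hr, Measure.smul_apply, Measure.dirac_apply_of_mem (mem_univ o), smul_eq_mul, mul_one,
      ← mul_two, mul_assoc,
      ENNReal.inv_mul_cancel (by simp) (by simp), mul_one]
  have hσm : μ univ + ((u'.snd + r) univ + (u'.snd + r) univ) = 1 := by
    rw [Measure.add_apply]
    calc _ = μ univ + (u'.snd univ + u'.snd univ) + (r univ + r univ) := by ring
      _ = 1 := by
        rw [half hu' huv', hr2, ← Measure.add_apply, add_tsub_cancel_of_le hm]
  -- Since `μ₁` and `ν₁` are coupled, the two mass constraints coincide.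
  have hμν : (μ + ν₀) univ = (ν + μ₀) univ := by
    rw [hμ', hν', Measure.add_apply, Measure.add_apply, Measure.add_apply, Measure.add_apply,
      measure_univ_eq_of_coupling hq₁ hq₂]
    ring
  have hτm : ν univ + ((u.snd + r) univ + (u.snd + r) univ) = 1 := by
    rw [Measure.add_apply]
    calc _ = ν univ + (u.snd univ + u.snd univ) + (r univ + r univ) := by ring
      _ = 1 := by
        rw [half hu huv, hr2, hμν, ← Measure.add_apply, add_tsub_cancel_of_le (hμν ▸ hm)]
  let σ : ChargedProb Y := chargedOfNeg μ (u'.snd + r) hμ.1 hσm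
  let τ : ChargedProb Y := chargedOfNeg ν (u.snd + r) hν.1 hτm
  let Δ : Measure (X × X) := r.map fun x => (x, x)
  have hΔ₁ : Δ.fst = r := fst_map_diag r
  have hΔ₂ : Δ.snd = r := snd_map_diag r
  have hΔ : ∫⁻ z, edist z.1 z.2 ^ p ∂Δ = 0 := by
    refine le_antisymm ((lintegral_map_diag_le _ _).trans_eq ?_) zero_le
    simp [ENNReal.zero_rpow_of_pos (show 0 < p by linarith)]
  -- `q` moves `μ₁` to `ν₁`. The plans `u` and `v` turn `μ₀` into neutral pairs in `τ`, the reversed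
  -- `u'` and `v'` create `ν₀` from neutral pairs in `σ`, and `Δ` keeps the idle pairs at rest.
  have main := wZero_rpow_le (μ := μ) (ν := ν) hp (σ := σ) (τ := τ) rfl rfl
    (qpp := q + u + u'.map Prod.swap + Δ) (qpm := v) (qmp := v'.map Prod.swap) (qmm := Δ)
    (by
      change _ = μ + (u'.snd + r)
      rw [Measure.fst_add, Measure.fst_add, Measure.fst_add, Measure.fst_map_swap, hΔ₁, hq₁, hμ',
        ← hu]
      abel)
    (by
      change _ = u'.snd + r
      rw [Measure.fst_map_swap, hΔ₁, huv'])
    (by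
      change _ = ν + (u.snd + r)
      rw [Measure.snd_add, Measure.snd_add, Measure.snd_add, Measure.snd_map_swap,
        Measure.snd_map_swap, hΔ₂, hq₂, hν', ← hu']
      abel)
    (by
      change _ = u.snd + r
      rw [hΔ₂, huv])
  refine main.trans ?_
  rw [lintegral_add_measure, lintegral_add_measure, lintegral_add_measure, hΔ, add_zero, add_zero]
  have s₁ := lintegral_map_swap_le (f := fun z : X × X => edist z.1 z.2 ^ p)
    (fun x y => by rw [edist_comm]) u'
  have s₂ := lintegral_map_swap_le (f := fun z : X × X => dStar Y z.1 z.2 ^ p)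
    (fun x y => by rw [dStar_comm]) v'
  calc _ ≤ ∫⁻ z, edist z.1 z.2 ^ p ∂q + ∫⁻ z, edist z.1 z.2 ^ p ∂u + ∫⁻ z, edist z.1 z.2 ^ p ∂u'
        + ∫⁻ z, dStar Y z.1 z.2 ^ p ∂v + ∫⁻ z, dStar Y z.1 z.2 ^ p ∂v' := by
        exact add_le_add (add_le_add_left (add_le_add_right s₁ _) _) s₂
    _ = _ := by ring

theorem wZero_rpow_le_decomposition [BorelSpace X] [SecondCountableTopology X]
    (hX : IsLengthSpace X) (hYo : IsOpen Y) (hYu : Y ≠ univ) (hp : 1 ≤ p)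
    {μ₁ μ₀ ν₁ ν₀ : Measure X} (hμ : IsSubprob Y μ) (hν : IsSubprob Y ν) (hμ' : μ = μ₁ + μ₀)
    (hν' : ν = ν₁ + ν₀) (hm : (μ + ν₀) univ ≤ 1) :
    WZero p Y μ ν ^ p ≤
      W p μ₁ ν₁ ^ p + annihilationCost p Y μ₀ ^ p + annihilationCost p Y ν₀ ^ p := by
  obtain ⟨o, -⟩ := nonempty_compl.2 hYu
  have hμ₀ : μ₀ Yᶜ = 0 := by
    have := hμ.1
    rw [hμ'] at this
    exact (add_eq_zero.1 this).2
  have hν₀ : ν₀ Yᶜ = 0 := by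
    have := hν.1
    rw [hν'] at this
    exact (add_eq_zero.1 this).2
  -- Midpoints exist only for factors above `1/2`. The exact constant in the annihilation cost comes
  -- from letting `κ` decrease to `1/2`.
  have hκ : ∀ κ : ℝ≥0∞, 2⁻¹ < κ → κ ≠ ∞ →
      WZero p Y μ ν ^ p ≤ W p μ₁ ν₁ ^ p + transportCost (dStar Y) p μ₀ μ₀ * κ ^ p +
        transportCost (dStar Y) p ν₀ ν₀ * κ ^ p := by
    intro κ hκ hκt
    have hpos : 0 < κ := lt_of_le_of_lt zero_le hκ
    have k0 : κ ^ p ≠ 0 := (ENNReal.rpow_pos hpos hκt).ne'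
    have kt : κ ^ p ≠ ∞ := ENNReal.rpow_ne_top_of_nonneg (by linarith) hκt
    rw [W, transportDist_rpow hp]
    simp only [transportCost_eq_iInf]
    simp only [ENNReal.iInf_mul_of_ne k0 kt, ENNReal.iInf_add, ENNReal.add_iInf]
    refine le_iInf fun q'' => le_iInf fun q' => le_iInf fun q => ?_
    obtain ⟨u, v, hu, huv, hc⟩ := exists_annihilation_plan hX hYo hYu hκ hp hμ₀ q'.2.1 q'.2.2
    obtain ⟨u', v', hu', huv', hc'⟩ :=
      exists_annihilation_plan hX hYo hYu hκ hp hν₀ q''.2.1 q''.2.2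
    refine (wZero_rpow_le_of_plans hp hμ hν hμ' hν' hm q.2.1 q.2.2 hu huv hu' huv' o).trans ?_
    gcongr
  rw [annihilationCost_rpow hp, annihilationCost_rpow hp]
  have ht : Tendsto (fun κ : ℝ≥0∞ => W p μ₁ ν₁ ^ p + transportCost (dStar Y) p μ₀ μ₀ * κ ^ p +
        transportCost (dStar Y) p ν₀ ν₀ * κ ^ p) (𝓝[>] 2⁻¹)
      (𝓝 (W p μ₁ ν₁ ^ p + transportCost (dStar Y) p μ₀ μ₀ * 2⁻¹ ^ p +
        transportCost (dStar Y) p ν₀ ν₀ * 2⁻¹ ^ p)) := by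
    have hk : Tendsto (fun κ : ℝ≥0∞ => κ ^ p) (𝓝[>] 2⁻¹) (𝓝 (2⁻¹ ^ p)) :=
      (ENNReal.continuous_rpow_const.tendsto _).mono_left nhdsWithin_le_nhds
    have k0 : (2⁻¹ : ℝ≥0∞) ^ p ≠ 0 := (ENNReal.rpow_pos (by simp) (by simp)).ne'
    exact (tendsto_const_nhds.add (ENNReal.Tendsto.const_mul hk (Or.inl k0))).add
      (ENNReal.Tendsto.const_mul hk (Or.inl k0))
  have : (𝓝[>] (2⁻¹ : ℝ≥0∞)).NeBot := nhdsGT_neBot_of_exists_gt ⟨1, by simp⟩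
  refine ge_of_tendsto ht ?_
  filter_upwards [self_mem_nhdsWithin,
    mem_nhdsWithin_of_mem_nhds
      (ENNReal.isOpen_ne_top.mem_nhds (by simp : (2⁻¹ : ℝ≥0∞) ≠ ∞))] with κ h h'
  exact hκ κ h h'

end UpperBound

/-! ### Measures and plans on a space with an added point -/

section PointedSum

variable {α : Type*} [MeasurableSpace α]

/-- The measure `μ + s δ_∂` on the disjoint union of a space with a point `∂`. -/
noncomputable def withPoint (μ : Measure α) (s : ℝ≥0∞) : Measure (α ⊕ Unit) :=
  μ.map Sum.inl + s • Measure.dirac (Sum.inr ())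

theorem withPoint_inj {μ ν : Measure α} {s t : ℝ≥0∞} :
    withPoint μ s = withPoint ν t ↔ μ = ν ∧ s = t := by
  refine ⟨fun h => ⟨?_, ?_⟩, fun h => by rw [h.1, h.2]⟩
  · ext S hS
    have hS' : MeasurableSet (Sum.inl '' S : Set (α ⊕ Unit)) :=
      hS.inl_image
    have := congrArg (fun m => m (Sum.inl '' S)) h
    simpa [withPoint, Measure.map_apply measurable_inl hS', hS',
      preimage_image_eq S Sum.inl_injective] using this
  · have hS' : MeasurableSet (range Sum.inr : Set (α ⊕ Unit)) := measurableSet_range_inr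
    have := congrArg (fun m => m (range Sum.inr)) h
    have h0 : (Sum.inl ⁻¹' range (Sum.inr : Unit → α ⊕ Unit)) = (∅ : Set α) := by
      ext x; simp
    simpa [withPoint, Measure.map_apply measurable_inl hS', hS', h0] using this

theorem withPoint_add (μ ν : Measure α) (s t : ℝ≥0∞) :
    withPoint (μ + ν) (s + t) = withPoint μ s + withPoint ν t := by
  rw [withPoint, withPoint, withPoint, Measure.map_add _ _ measurable_inl, add_smul]
  abel

theorem withPoint_univ (μ : Measure α) (s : ℝ≥0∞) : withPoint μ s univ = μ univ + s := by
  simp [withPoint, Measure.map_apply measurable_inl MeasurableSet.univ]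

theorem lintegral_withPoint (μ : Measure α) (s : ℝ≥0∞) {f : α ⊕ Unit → ℝ≥0∞}
    (hf : Measurable f) :
    ∫⁻ z, f z ∂(withPoint μ s) = ∫⁻ x, f (.inl x) ∂μ + s * f (.inr ()) := by
  rw [withPoint, lintegral_add_measure, lintegral_map hf measurable_inl, lintegral_smul_measure,
    lintegral_dirac' _ hf, smul_eq_mul]

/-- The transport plan on `α ∪ {∂}` that consists of a plan `q` in `α`, of the transport of `a`
to `∂`, of the transport of `∂` to `b`, and of a mass `m` that stays at `∂`. -/
noncomputable def pointedPlan (q : Measure (α × α)) (a b : Measure α) (m : ℝ≥0∞) :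
    Measure ((α ⊕ Unit) × (α ⊕ Unit)) :=
  q.map (Prod.map Sum.inl Sum.inl) + a.map (fun x => (Sum.inl x, Sum.inr ())) +
    b.map (fun y => (Sum.inr (), Sum.inl y)) + m • Measure.dirac (Sum.inr (), Sum.inr ())

variable (q : Measure (α × α)) (a b : Measure α) (m : ℝ≥0∞)

theorem map_pointedPlan {β : Type*} [MeasurableSpace β] {f : (α ⊕ Unit) × (α ⊕ Unit) → β}
    (hf : Measurable f) : (pointedPlan q a b m).map f =
      q.map (fun z => f (.inl z.1, .inl z.2)) + a.map (fun x => f (.inl x, .inr ())) +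
        b.map (fun y => f (.inr (), .inl y)) + m • Measure.dirac (f (.inr (), .inr ())) := by
  rw [pointedPlan, Measure.map_add _ _ hf, Measure.map_add _ _ hf, Measure.map_add _ _ hf,
    Measure.map_smul, Measure.map_dirac' hf, Measure.map_map hf (by fun_prop),
    Measure.map_map hf (by fun_prop), Measure.map_map hf (by fun_prop)]
  rfl

theorem fst_pointedPlan : (pointedPlan q a b m).fst = withPoint (q.fst + a) (b univ + m) := by
  rw [Measure.fst, map_pointedPlan q a b m measurable_fst, withPoint,
    Measure.map_add _ _ measurable_inl, Measure.fst, Measure.map_map measurable_inl measurable_fst,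
    add_smul, Measure.map_const]
  simp only [Function.comp_def]
  abel

theorem snd_pointedPlan : (pointedPlan q a b m).snd = withPoint (q.snd + b) (a univ + m) := by
  rw [Measure.snd, map_pointedPlan q a b m measurable_snd, withPoint,
    Measure.map_add _ _ measurable_inl, Measure.snd, Measure.map_map measurable_inl measurable_snd,
    add_smul, Measure.map_const]
  simp only [Function.comp_def]
  abel

theorem lintegral_pointedPlan {c : α ⊕ Unit → α ⊕ Unit → ℝ≥0∞}
    (hc : Measurable (Function.uncurry c)) :
    ∫⁻ z, c z.1 z.2 ∂(pointedPlan q a b m) = ∫⁻ z, c (.inl z.1) (.inl z.2) ∂q +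
      ∫⁻ x, c (.inl x) (.inr ()) ∂a + ∫⁻ y, c (.inr ()) (.inl y) ∂b +
        m * c (.inr ()) (.inr ()) := by
  change ∫⁻ z, Function.uncurry c z ∂(pointedPlan q a b m) = _
  rw [pointedPlan, lintegral_add_measure, lintegral_add_measure, lintegral_add_measure,
    lintegral_map hc (by fun_prop), lintegral_map hc (by fun_prop), lintegral_map hc (by fun_prop),
    lintegral_smul_measure, lintegral_dirac' _ hc, smul_eq_mul]
  rfl

theorem map_map_restrict_of_leftInvOn {β γ : Type*} [MeasurableSpace β] [MeasurableSpace γ]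
    (Q : Measure β) {S : Set β} (hS : MeasurableSet S) {f : γ → β} {g : β → γ} (hf : Measurable f)
    (hg : Measurable g) (h : ∀ z ∈ S, f (g z) = z) :
    ((Q.restrict S).map g).map f = Q.restrict S := by
  rw [Measure.map_map hf hg]
  conv_rhs => rw [← Measure.map_id (μ := Q.restrict S)]
  refine Measure.map_congr ?_
  filter_upwards [ae_restrict_mem hS] with z hz
  exact h z hz

/-- The four blocks come from restricting `Q` according to which coordinates lie in `α`. -/
theorem exists_eq_pointedPlan [Nonempty α] (Q : Measure ((α ⊕ Unit) × (α ⊕ Unit))) :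
    ∃ (q : Measure (α × α)) (a b : Measure α) (m : ℝ≥0∞), Q = pointedPlan q a b m := by
  obtain ⟨o⟩ := ‹Nonempty α›
  -- The value `o` at the added point is arbitrary: `π` is applied only to coordinates that lie in
  -- `α` on the respective block.
  let π : α ⊕ Unit → α := Sum.elim id fun _ => o
  have hπ : Measurable π := by fun_prop
  let L : Set (α ⊕ Unit) := range Sum.inl
  have hL : MeasurableSet L := measurableSet_range_inl
  let S₁ : Set ((α ⊕ Unit) × (α ⊕ Unit)) := Prod.fst ⁻¹' L
  let S₂ : Set ((α ⊕ Unit) × (α ⊕ Unit)) := Prod.snd ⁻¹' L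
  have hS₁ : MeasurableSet S₁ := measurable_fst hL
  have hS₂ : MeasurableSet S₂ := measurable_snd hL
  have hQ : Q = Q.restrict (S₂ ∩ S₁) + Q.restrict (S₂ᶜ ∩ S₁) + Q.restrict (S₂ ∩ S₁ᶜ) +
      Q.restrict (S₂ᶜ ∩ S₁ᶜ) := by
    rw [← Measure.restrict_restrict hS₂, ← Measure.restrict_restrict hS₂.compl,
      Measure.restrict_add_restrict_compl hS₂, ← Measure.restrict_restrict hS₂,
      ← Measure.restrict_restrict hS₂.compl, add_assoc, Measure.restrict_add_restrict_compl hS₂,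
      Measure.restrict_add_restrict_compl hS₁]
  refine ⟨(Q.restrict (S₂ ∩ S₁)).map (Prod.map π π), (Q.restrict (S₂ᶜ ∩ S₁)).map (π ∘ Prod.fst),
    (Q.restrict (S₂ ∩ S₁ᶜ)).map (π ∘ Prod.snd), Q (S₂ᶜ ∩ S₁ᶜ), ?_⟩
  conv_lhs => rw [hQ]
  rw [pointedPlan]
  congr 1
  · congr 1
    · congr 1
      · refine (map_map_restrict_of_leftInvOn Q (hS₂.inter hS₁) (by fun_prop) (by fun_prop)
          ?_).symm
        rintro ⟨_, _⟩ ⟨⟨y, rfl⟩, ⟨x, rfl⟩⟩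
        rfl
      · refine (map_map_restrict_of_leftInvOn Q (hS₂.compl.inter hS₁) (by fun_prop) (by fun_prop)
          ?_).symm
        rintro ⟨_, y | y⟩ ⟨hy, ⟨x, rfl⟩⟩
        · exact absurd ⟨y, rfl⟩ hy
        · rfl
    · refine (map_map_restrict_of_leftInvOn Q (hS₂.inter hS₁.compl) (by fun_prop) (by fun_prop)
        ?_).symm
      rintro ⟨x | x, _⟩ ⟨⟨y, rfl⟩, hx⟩
      · exact absurd ⟨x, rfl⟩ hx
      · rfl
  · have := map_map_restrict_of_leftInvOn Q (hS₂.compl.inter hS₁.compl)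
      (f := fun _ : Unit => ((Sum.inr (), Sum.inr ()) : (α ⊕ Unit) × (α ⊕ Unit)))
      (g := fun _ => ()) (by fun_prop) (by fun_prop) (by
        rintro ⟨x | x, y | y⟩ ⟨hy, hx⟩
        · exact absurd ⟨x, rfl⟩ hx
        · exact absurd ⟨x, rfl⟩ hx
        · exact absurd ⟨y, rfl⟩ hy
        · rfl)
    rw [← this, Measure.map_const, Measure.map_apply (by fun_prop) MeasurableSet.univ]
    simp

end PointedSum

/-! ### The cost of moving, dying and being born -/

section KillCost

variable {X : Type*} [MetricSpace X] {Y : Set X}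

/-- The cost of moving in `X`, with the possibility of dying and of being born at the boundary. -/
noncomputable def killCost (Y : Set X) : X ⊕ Unit → X ⊕ Unit → ℝ≥0∞
  | .inl x, .inl y => edist x y
  | .inl x, .inr _ => dBdry Y x
  | .inr _, .inl y => dBdry Y y
  | .inr _, .inr _ => 0

/-- The middle point has to lie in `X`: through `∂` the inequality would say `d ≤ d†`. This is why
cancellation asks for the triangle inequality only at the points of the cancelled measure. -/
theorem killCost_triangle (y : X) (x z : X ⊕ Unit) :
    killCost Y x z ≤ killCost Y x (.inl y) + killCost Y (.inl y) z := by
  rcases x with x | x <;> rcases z with z | z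
  · exact edist_triangle x y z
  · exact dBdry_le_edist_add x y
  · change dBdry Y z ≤ dBdry Y y + edist y z
    rw [add_comm, edist_comm]
    exact dBdry_le_edist_add z y
  · exact zero_le

theorem measurable_killCost [MeasurableSpace X] [BorelSpace X] [SecondCountableTopology X] :
    Measurable (Function.uncurry (killCost Y)) := by
  refine measurable_sum_prod_sum ?_ ?_ ?_ ?_
  · exact measurable_edist_prod
  · exact measurable_dBdry.comp measurable_fst
  · exact measurable_dBdry.comp measurable_snd
  · exact measurable_const

end KillCost

/-! ### Lower bound for `W⁰₁` -/

section LowerBound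

variable {X : Type*} [MeasurableSpace X] {Y : Set X} {μ ν : Measure X}

theorem IsSubprob.isFiniteMeasure (h : IsSubprob Y μ) : IsFiniteMeasure μ :=
  ⟨h.2.trans_lt ENNReal.one_lt_top⟩

variable [MetricSpace X]

theorem lintegral_edist_lt_top [IsFiniteMeasure μ] {o : X}
    (h : ∫⁻ x, edist x o ∂μ < ∞) (o' : X) : ∫⁻ x, edist x o' ∂μ < ∞ := by
  calc ∫⁻ x, edist x o' ∂μ ≤ ∫⁻ x, (edist x o + edist o o') ∂μ :=
        lintegral_mono fun x => edist_triangle _ _ _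
    _ = ∫⁻ x, edist x o ∂μ + edist o o' * μ univ := by
        rw [lintegral_add_right _ measurable_const, lintegral_const]
    _ < ∞ := ENNReal.add_lt_top.2 ⟨h, by finiteness⟩

variable [BorelSpace X]

/-- The right-hand side of the formula for `W⁰₁`. -/
noncomputable def constrainedCost (Y : Set X) (μ ν : Measure X) : ℝ≥0∞ :=
  ⨅ (μ₁ : Measure X) (μ₀ : Measure X) (ν₁ : Measure X) (ν₀ : Measure X)
    (_ : μ = μ₁ + μ₀) (_ : ν = ν₁ + ν₀)
    (_ : (μ + ν₀) Set.univ ≤ 1) (_ : (ν + μ₀) Set.univ ≤ 1),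
    W 1 μ₁ ν₁ + annihilationCost 1 Y μ₀ + annihilationCost 1 Y ν₀

variable [SecondCountableTopology X]

/-- The mass born is at most the supply `s` at `∂`, and the mass that dies is at most the capacity
`t`. These bounds are the mass constraints of the decomposition. -/
theorem constrainedCost_le_killCost [Nonempty X] {s t : ℝ≥0∞} (hs : μ univ + s ≤ 1)
    (ht : ν univ + t ≤ 1) :
    constrainedCost Y μ ν ≤ transportCost (killCost Y) 1 (withPoint μ s) (withPoint ν t) := by
  refine le_iInf fun Q => le_iInf fun h₁ => le_iInf fun h₂ => ?_
  obtain ⟨q, a, b, m, rfl⟩ := exists_eq_pointedPlan Q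
  rw [fst_pointedPlan, withPoint_inj] at h₁
  rw [snd_pointedPlan, withPoint_inj] at h₂
  refine iInf_le_of_le q.fst <| iInf_le_of_le a <| iInf_le_of_le q.snd <| iInf_le_of_le b <|
    iInf_le_of_le h₁.1.symm <| iInf_le_of_le h₂.1.symm <| iInf_le_of_le ?_ <|
    iInf_le_of_le ?_ ?_
  · refine le_trans ?_ hs
    rw [Measure.add_apply, ← h₁.2]
    gcongr
    exact le_self_add
  · refine le_trans ?_ ht
    rw [Measure.add_apply, ← h₂.2]
    gcongr
    exact le_self_add
  · simp only [ENNReal.rpow_one]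
    rw [lintegral_pointedPlan q a b m measurable_killCost, W, transportDist_one,
      annihilationCost_one, annihilationCost_one]
    refine le_trans ?_ le_self_add
    gcongr
    · exact transportCost_one_le
    all_goals rfl

theorem constrainedCost_le_wZero [StandardBorelSpace X] (hYu : Y ≠ univ) (hμ : IsSubprobP 1 Y μ)
    (hν : IsSubprobP 1 Y ν) : constrainedCost Y μ ν ≤ WZero 1 Y μ ν := by
  have := hμ.1.isFiniteMeasure
  have := hν.1.isFiniteMeasure
  obtain ⟨o, -, hoμ⟩ := hμ.exists_lintegral_edist_lt
  obtain ⟨o', -, hoν⟩ := hν.exists_lintegral_edist_lt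
  replace hoν := lintegral_edist_lt_top hoν o
  have : Nonempty X := ⟨o⟩
  refine le_iInf fun σ => le_iInf fun τ => le_iInf fun hσ => le_iInf fun hτ => ?_
  rw [WTilde, div_one, ENNReal.rpow_one]
  refine le_iInf fun qpp => le_iInf fun qpm => le_iInf fun qmp => le_iInf fun qmm =>
    le_iInf fun h₁ => le_iInf fun h₂ => le_iInf fun h₃ => le_iInf fun h₄ => ?_
  simp only [ENNReal.rpow_one]
  have hσ1 : μ univ + (σ.neg univ + σ.neg univ) = 1 := by
    rw [← σ.mass_eq, hσ, Measure.add_apply, add_assoc]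
  have hτ1 : ν univ + (τ.neg univ + τ.neg univ) = 1 := by
    rw [← τ.mass_eq, hτ, Measure.add_apply, add_assoc]
  have hσf : IsFiniteMeasure σ.neg := ⟨lt_of_le_of_lt
    ((le_self_add.trans le_add_self).trans hσ1.le) ENNReal.one_lt_top⟩
  have hτf : IsFiniteMeasure τ.neg := ⟨lt_of_le_of_lt
    ((le_self_add.trans le_add_self).trans hτ1.le) ENNReal.one_lt_top⟩
  -- Both ends of a change from particle to antiparticle die, and both ends of the opposite change
  -- are born. These masses are at most `2 τ⁻(X)` and `2 σ⁻(X)`, which is exactly the room left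
  -- beside `ν` and `μ`.
  set a : Measure X := qpm.fst + qpm.snd with ha
  set b : Measure X := qmp.fst + qmp.snd with hb
  have hau : a univ ≤ τ.neg univ + τ.neg univ := by
    rw [ha, Measure.add_apply, Measure.fst_univ, ← Measure.snd_univ, ← h₄, Measure.add_apply]
    gcongr <;> exact le_self_add
  have hbu : b univ ≤ σ.neg univ + σ.neg univ := by
    rw [hb, Measure.add_apply, Measure.snd_univ, ← Measure.fst_univ, ← h₂, Measure.add_apply]
    gcongr <;> exact le_self_add
  have hbt : b univ ≠ ∞ := (hbu.trans_lt (by finiteness)).ne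
  have hat : a univ ≠ ∞ := (hau.trans_lt (by finiteness)).ne
  refine (constrainedCost_le_killCost (s := b univ) (t := a univ)
    (hσ1 ▸ by gcongr) (hτ1 ▸ by gcongr)).trans ?_
  -- An envelope with `killCost x y ≤ e x + e y`; its integrals are finite by the first moments of
  -- `μ` and `ν`.
  let e : X ⊕ Unit → ℝ≥0∞ := Sum.elim (fun x => edist x o) fun _ => dBdry Y o
  have he : Measurable e := Measurable.sumElim (by fun_prop) measurable_const
  have hfin : ∀ {m : Measure X} [IsFiniteMeasure m] {s : ℝ≥0∞}, s ≠ ∞ →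
      IsFiniteMeasure (withPoint m s) := fun {m} _ {s} hs =>
    ⟨by rw [withPoint_univ]; finiteness⟩
  have hint : ∀ {m : Measure X} {s : ℝ≥0∞}, ∫⁻ x, edist x o ∂m < ∞ → s ≠ ∞ →
      ∫⁻ z, e z ∂(withPoint m s) ≠ ∞ := by
    intro m s hm hs
    rw [lintegral_withPoint _ _ he]
    exact ENNReal.add_ne_top.2 ⟨hm.ne, ENNReal.mul_ne_top hs (dBdry_ne_top hYu o)⟩
  have := hfin (m := μ) hbt
  have := hfin (m := ν) hat
  have := hfin (m := σ.neg + τ.neg) ENNReal.zero_ne_top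
  have hae : ∀ᵐ y ∂(withPoint (σ.neg + τ.neg) 0), ∀ x z,
      killCost Y x z ≤ killCost Y x y + killCost Y y z := by
    have hr : ∀ᵐ y ∂(withPoint (σ.neg + τ.neg) 0), y ∈ range Sum.inl := by
      rw [withPoint, zero_smul, add_zero, ae_map_iff (p := fun y => y ∈ range Sum.inl)
        measurable_inl.aemeasurable measurableSet_range_inl]
      exact ae_of_all _ fun x => mem_range_self x
    filter_upwards [hr]
    rintro _ ⟨y, rfl⟩
    exact killCost_triangle y
  -- With `q⁻⁻` reversed, the departures in `X` add up to `σ⁺ + τ⁻ = μ + (σ⁻ + τ⁻)` and the arrivals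
  -- to `τ⁺ + σ⁻ = ν + (σ⁻ + τ⁻)`. The cancelled part has no mass at `∂`.
  have main := transportCost_le_of_cancel measurable_killCost (a := withPoint μ (b univ))
    (b := withPoint ν (a univ)) (r := withPoint (σ.neg + τ.neg) 0) hae he
    (by
      rintro (x | x) (y | y)
      · exact edist_triangle_right x y o
      · exact dBdry_le_edist_add x o
      · exact (dBdry_le_edist_add y o).trans_eq (add_comm _ _)
      · exact zero_le)
    (hint hoμ hbt) (hint hoν hat)
    (q := pointedPlan (qpp + qmm.map Prod.swap) a b 0)
    (by
      rw [fst_pointedPlan, ← withPoint_add, withPoint_inj, Measure.fst_add, Measure.fst_map_swap]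
      refine ⟨?_, rfl⟩
      calc qpp.fst + qmm.snd + a = (qpp.fst + qpm.fst) + (qpm.snd + qmm.snd) := by rw [ha]; abel
        _ = _ := by rw [h₁, h₄, hσ]; abel)
    (by
      rw [snd_pointedPlan, ← withPoint_add, withPoint_inj, Measure.snd_add, Measure.snd_map_swap]
      refine ⟨?_, rfl⟩
      calc qpp.snd + qmm.fst + b = (qpp.snd + qmp.snd) + (qmp.fst + qmm.fst) := by rw [hb]; abel
        _ = _ := by rw [h₃, h₂, hτ]; abel)
  refine main.trans ?_
  rw [lintegral_pointedPlan _ _ _ _ measurable_killCost, zero_mul, add_zero,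
    lintegral_add_measure]
  have hs : ∀ q : Measure (X × X), ∫⁻ x, dBdry Y x ∂(q.fst + q.snd) ≤
      ∫⁻ z, dStar Y z.1 z.2 ∂q := by
    intro q
    rw [lintegral_add_measure, lintegral_fst_add_snd measurable_dBdry]
    exact lintegral_mono fun z => dBdry_add_le_dStar _ _
  have hsw := lintegral_map_swap_le (f := fun z : X × X => edist z.1 z.2)
    (fun x y => edist_comm _ _) qmm
  calc _ ≤ (∫⁻ z, edist z.1 z.2 ∂qpp + ∫⁻ z, edist z.1 z.2 ∂qmm) + ∫⁻ z, dStar Y z.1 z.2 ∂qpm +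
        ∫⁻ z, dStar Y z.1 z.2 ∂qmp :=
        add_le_add (add_le_add (add_le_add_right hsw _) (hs qpm)) (hs qmp)
    _ = _ := by ring

end LowerBound

/-! ### Measures on `Y` and measures on `X` -/

section Subtype

variable {X : Type*} [MeasurableSpace X] {Y : Set X}

theorem map_comap_val (hY : MeasurableSet Y) {μ : Measure X} (hμ : μ Yᶜ = 0) :
    (μ.comap (Subtype.val : Y → X)).map Subtype.val = μ := by
  rw [map_comap_subtype_coe hY, Measure.restrict_eq_self_of_ae_mem hμ]

theorem comap_map_val (hY : MeasurableSet Y) (μ : Measure Y) :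
    (μ.map (Subtype.val : Y → X)).comap Subtype.val = μ :=
  (MeasurableEmbedding.subtype_coe hY).comap_map μ

theorem comap_val_univ (hY : MeasurableSet Y) (μ : Measure X) :
    (μ.comap (Subtype.val : Y → X)) univ = μ Y := by
  rw [(MeasurableEmbedding.subtype_coe hY).comap_apply]
  simp

theorem fst_map_prodMap_val (q : Measure (Y × Y)) :
    (q.map (Prod.map Subtype.val Subtype.val) : Measure (X × X)).fst = q.fst.map Subtype.val := by
  rw [Measure.fst, Measure.fst, Measure.map_map (by fun_prop) (by fun_prop),
    Measure.map_map (by fun_prop) (by fun_prop)]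
  rfl

theorem snd_map_prodMap_val (q : Measure (Y × Y)) :
    (q.map (Prod.map Subtype.val Subtype.val) : Measure (X × X)).snd = q.snd.map Subtype.val := by
  rw [Measure.snd, Measure.snd, Measure.map_map (by fun_prop) (by fun_prop),
    Measure.map_map (by fun_prop) (by fun_prop)]
  rfl

theorem lintegral_map_prodMap_val (hY : MeasurableSet Y) (q : Measure (Y × Y))
    (f : X × X → ℝ≥0∞) : ∫⁻ z, f z ∂(q.map (Prod.map Subtype.val Subtype.val)) =
      ∫⁻ z, f (z.1, z.2) ∂q :=
  ((MeasurableEmbedding.subtype_coe hY).prodMap (MeasurableEmbedding.subtype_coe hY)).lintegral_map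
    _

/-- A plan between measures on `Y` is a plan on `Y × Y`. -/
theorem exists_plan_subtype (hY : MeasurableSet Y) {q : Measure (X × X)} (h₁ : q.fst Yᶜ = 0)
    (h₂ : q.snd Yᶜ = 0) :
    ∃ q' : Measure (Y × Y), q = q'.map (Prod.map Subtype.val Subtype.val) := by
  have he := (MeasurableEmbedding.subtype_coe hY).prodMap (MeasurableEmbedding.subtype_coe hY)
  refine ⟨q.comap (Prod.map Subtype.val Subtype.val), ?_⟩
  rw [he.map_comap, Measure.restrict_eq_self_of_ae_mem]
  rw [Measure.fst_apply hY.compl] at h₁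
  rw [Measure.snd_apply hY.compl] at h₂
  have h₁' : ∀ᵐ z ∂q, z.1 ∈ Y := h₁
  have h₂' : ∀ᵐ z ∂q, z.2 ∈ Y := h₂
  filter_upwards [h₁', h₂'] with z hz₁ hz₂
  exact ⟨(⟨z.1, hz₁⟩, ⟨z.2, hz₂⟩), rfl⟩

theorem toCompletion_eq_withPoint (μ : Measure X) :
    toCompletion Y μ = withPoint (μ.comap (Subtype.val : Y → X)) (1 - μ Y) := rfl

theorem toCompletion_zero : toCompletion Y (0 : Measure X) = withPoint 0 1 := by
  rw [toCompletion_eq_withPoint]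
  simp

theorem IsSubprob.apply_le_one {μ : Measure X} (h : IsSubprob Y μ) : μ Y ≤ 1 :=
  (measure_mono (subset_univ Y)).trans h.2

theorem IsSubprob.of_add_left {μ a b : Measure X} (h : IsSubprob Y μ) (hμ : μ = a + b) :
    IsSubprob Y a := by
  have hle : a ≤ μ := by rw [hμ]; exact Measure.le_add_right le_rfl
  exact ⟨le_antisymm ((hle _).trans_eq h.1) zero_le, (hle _).trans h.2⟩

theorem IsSubprob.of_add_right {μ a b : Measure X} (h : IsSubprob Y μ) (hμ : μ = a + b) :
    IsSubprob Y b :=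
  h.of_add_left (hμ.trans (add_comm a b))

theorem isProbabilityMeasure_toCompletion (hY : MeasurableSet Y) (hμ : IsSubprob Y μ) :
    IsProbabilityMeasure (toCompletion Y μ) :=
  ⟨by rw [toCompletion_eq_withPoint, withPoint_univ, comap_val_univ hY,
    add_tsub_cancel_of_le hμ.apply_le_one]⟩

end Subtype

/-! ### The shortcut metric and the decomposition of `W'_p` -/

section Shortcut

variable {X : Type*} [MetricSpace X] {Y : Set X}

theorem dPrime_triangle (x y z : Completion Y) :
    dPrime Y x z ≤ dPrime Y x y + dPrime Y y z := by
  have key : ∀ a b : X, dBdry Y a ≤ min (edist a b) (dBdry Y a + dBdry Y b) + dBdry Y b := by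
    intro a b
    rcases le_total (edist a b) (dBdry Y a + dBdry Y b) with h | h
    · rw [min_eq_left h]; exact dBdry_le_edist_add a b
    · rw [min_eq_right h, add_assoc]; exact le_self_add
  have symm : ∀ a b : X, min (edist a b) (dBdry Y a + dBdry Y b) =
      min (edist b a) (dBdry Y b + dBdry Y a) := by
    intro a b
    rw [edist_comm, add_comm]
  rcases x with x | x <;> rcases y with y | y <;> rcases z with z | z <;> simp only [dPrime]
  · rcases le_total (edist (x : X) y) (dBdry Y x + dBdry Y y) with h | h
    · rcases le_total (edist (y : X) z) (dBdry Y y + dBdry Y z) with h' | h'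
      · rw [min_eq_left h, min_eq_left h']
        exact (min_le_left _ _).trans (edist_triangle _ _ _)
      · rw [min_eq_left h, min_eq_right h', ← add_assoc]
        refine (min_le_right _ _).trans ?_
        gcongr
        exact dBdry_le_edist_add _ _
    · rw [min_eq_right h, add_assoc]
      refine (min_le_right _ _).trans ?_
      gcongr
      rw [symm, add_comm]
      exact key _ _
  · exact key _ _
  · exact min_le_right _ _
  · simp
  · rw [symm, add_comm]
    exact key _ _
  · exact zero_le
  · simp
  · simp

variable [MeasurableSpace X] {p : ℝ} {μ ν : Measure X}

theorem wPrime_rpow (hp : 1 ≤ p) : WPrime p Y μ ν ^ p =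
    transportCost (dPrime Y) p (toCompletion Y μ) (toCompletion Y ν) :=
  transportDist_rpow hp

variable [BorelSpace X] [SecondCountableTopology X]

theorem measurable_dPrime : Measurable (Function.uncurry (dPrime Y)) := by
  have hb : Measurable fun y : Y => dBdry Y y := measurable_dBdry.comp measurable_subtype_coe
  have he : Measurable fun z : Y × Y => edist (z.1 : X) z.2 :=
    measurable_edist_prod.comp (measurable_subtype_coe.prodMap measurable_subtype_coe)
  refine measurable_sum_prod_sum ?_ ?_ ?_ ?_
  · exact he.min ((hb.comp measurable_fst).add (hb.comp measurable_snd))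
  · exact hb.comp measurable_fst
  · exact hb.comp measurable_snd
  · exact measurable_const

theorem measurable_dPrime_rpow (p : ℝ) :
    Measurable (Function.uncurry fun x y => dPrime Y x y ^ p) :=
  measurable_dPrime.pow_const p

theorem lintegral_dPrime_pointedPlan (hp : 0 < p) (q : Measure (Y × Y)) (a b : Measure Y)
    (m : ℝ≥0∞) : ∫⁻ z, dPrime Y z.1 z.2 ^ p ∂(pointedPlan q a b m) =
      ∫⁻ z, min (edist (z.1 : X) z.2) (dDagger Y z.1 z.2) ^ p ∂q +
        ∫⁻ y : Y, dBdry Y y ^ p ∂a + ∫⁻ y : Y, dBdry Y y ^ p ∂b := by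
  rw [lintegral_pointedPlan _ _ _ _ (measurable_dPrime_rpow p)]
  simp only [dPrime, ENNReal.zero_rpow_of_pos hp, mul_zero, add_zero, dDagger]

theorem wPrime_zero_rpow (hY : MeasurableSet Y) (hne : Y.Nonempty) (hp : 1 ≤ p)
    (hμ : IsSubprob Y μ) : WPrime p Y μ 0 ^ p = ∫⁻ x in Y, dBdry Y x ^ p ∂μ := by
  have : Nonempty Y := hne.to_subtype
  have hp0 : 0 < p := by linarith
  have hint : ∫⁻ x in Y, dBdry Y x ^ p ∂μ = ∫⁻ y : Y, dBdry Y y ^ p ∂(μ.comap Subtype.val) :=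
    (lintegral_subtype_comap hY _).symm
  rw [wPrime_rpow hp, hint, toCompletion_zero, toCompletion_eq_withPoint]
  apply le_antisymm
  · refine (transportCost_le_lintegral (q := pointedPlan 0 (μ.comap Subtype.val) 0 (1 - μ Y))
      ?_ ?_).trans_eq ?_
    · rw [fst_pointedPlan]
      simp
    · rw [snd_pointedPlan, withPoint_inj, comap_val_univ hY,
        add_tsub_cancel_of_le hμ.apply_le_one]
      simp
    · rw [lintegral_dPrime_pointedPlan hp0]
      simp
  · refine le_iInf fun Q => le_iInf fun h₁ => le_iInf fun h₂ => ?_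
    obtain ⟨q, a, b, m, rfl⟩ := exists_eq_pointedPlan Q
    rw [fst_pointedPlan, withPoint_inj] at h₁
    rw [snd_pointedPlan, withPoint_inj] at h₂
    -- The target is the unit mass at `∂`, so nothing may arrive in `Y`.
    have hq : q = 0 := by
      rw [← Measure.measure_univ_eq_zero, ← Measure.snd_univ]
      have := congrArg (fun m => m univ) h₂.1
      exact (add_eq_zero.1 this).1
    rw [← h₁.1, hq, Measure.fst_zero, zero_add, lintegral_dPrime_pointedPlan hp0]
    exact le_add_self.trans le_self_add

theorem wPrime_zero_rpow' (hY : MeasurableSet Y) (hne : Y.Nonempty) (hp : 1 ≤ p)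
    (hμ : IsSubprob Y μ) : WPrime p Y μ 0 ^ p = ∫⁻ x, dBdry Y x ^ p ∂μ := by
  rw [wPrime_zero_rpow hY hne hp hμ, Measure.restrict_eq_self_of_ae_mem hμ.1]

theorem wPrime_zero_one (hY : MeasurableSet Y) (hne : Y.Nonempty) (hμ : IsSubprob Y μ) :
    WPrime 1 Y μ 0 = annihilationCost 1 Y μ := by
  rw [annihilationCost_one]
  simpa using wPrime_zero_rpow' hY hne le_rfl hμ

theorem wPrime_rpow_le_of_plans (hY : MeasurableSet Y) (hp : 1 ≤ p)
    {μ₁ μ₂ μ₀ ν₁ ν₂ ν₀ : Measure X} (hμ : IsSubprob Y μ) (hν : IsSubprob Y ν)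
    (hμ' : μ = μ₁ + μ₂ + μ₀) (hν' : ν = ν₁ + ν₂ + ν₀) (hm : (μ + ν₀) Y ≤ 1)
    {q₁ q₂ : Measure (X × X)} (h₁ : q₁.fst = μ₁) (h₁' : q₁.snd = ν₁) (h₂ : q₂.fst = μ₂)
    (h₂' : q₂.snd = ν₂) :
    WPrime p Y μ ν ^ p ≤ ∫⁻ z, edist z.1 z.2 ^ p ∂q₁ + ∫⁻ z, dDagger Y z.1 z.2 ^ p ∂q₂ +
      ∫⁻ x, dBdry Y x ^ p ∂μ₀ + ∫⁻ x, dBdry Y x ^ p ∂ν₀ := by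
  have hp0 : 0 < p := by linarith
  have hμ₁₂ := hμ.of_add_left hμ'
  have hν₁₂ := hν.of_add_left hν'
  have hμ₀ := (hμ.of_add_right hμ')
  have hν₀ := (hν.of_add_right hν')
  have hmass : (μ + ν₀) Y = (ν + μ₀) Y := by
    have e : (μ + ν₀) univ = (ν + μ₀) univ := by
      rw [hμ', hν']
      simp only [Measure.add_apply]
      rw [measure_univ_eq_of_coupling h₁ h₁', measure_univ_eq_of_coupling h₂ h₂']
      ring
    have f : (μ + ν₀) Yᶜ = 0 ∧ (ν + μ₀) Yᶜ = 0 := by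
      simp [hμ.1, hν.1, hμ₀.1, hν₀.1]
    rwa [← measure_add_measure_compl hY, f.1, add_zero,
      ← measure_add_measure_compl hY (μ := ν + μ₀),
      f.2, add_zero] at e
  have hμ₁ := hμ₁₂.of_add_left rfl
  have hμ₂ := hμ₁₂.of_add_right rfl
  have hν₁ := hν₁₂.of_add_left rfl
  have hν₂ := hν₁₂.of_add_right rfl
  obtain ⟨r₁, rfl⟩ := exists_plan_subtype hY (h₁ ▸ hμ₁.1) (h₁' ▸ hν₁.1)
  obtain ⟨r₂, rfl⟩ := exists_plan_subtype hY (h₂ ▸ hμ₂.1) (h₂' ▸ hν₂.1)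
  rw [fst_map_prodMap_val] at h₁ h₂
  rw [snd_map_prodMap_val] at h₁' h₂'
  rw [lintegral_map_prodMap_val hY, lintegral_map_prodMap_val hY]
  obtain ⟨a, rfl⟩ : ∃ a : Measure Y, μ₀ = a.map Subtype.val := ⟨_, (map_comap_val hY hμ₀.1).symm⟩
  obtain ⟨b, rfl⟩ : ∃ b : Measure Y, ν₀ = b.map Subtype.val := ⟨_, (map_comap_val hY hν₀.1).symm⟩
  have hme := MeasurableEmbedding.subtype_coe hY
  have hμc : μ.comap (Subtype.val : Y → X) = r₁.fst + r₂.fst + a := by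
    rw [hμ', ← h₁, ← h₂, ← Measure.map_add _ _ hme.measurable,
      ← Measure.map_add _ _ hme.measurable, comap_map_val hY]
  have hνc : ν.comap (Subtype.val : Y → X) = r₁.snd + r₂.snd + b := by
    rw [hν', ← h₁', ← h₂', ← Measure.map_add _ _ hme.measurable,
      ← Measure.map_add _ _ hme.measurable, comap_map_val hY]
  have hau : (a.map (Subtype.val : Y → X)) Y = a univ := by
    rw [Measure.map_apply hme.measurable hY]; simp
  have hbu : (b.map (Subtype.val : Y → X)) Y = b univ := by
    rw [Measure.map_apply hme.measurable hY]; simp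
  -- The mass `1 - s` at `∂` is what is born, `t`, together with what stays there, `1 - (s + t)`.
  have rest : ∀ s t : ℝ≥0∞, s ≤ 1 → s + t ≤ 1 → t + (1 - (s + t)) = 1 - s := by
    intro s t hs h
    have hst : s ≠ ∞ := (hs.trans_lt ENNReal.one_lt_top).ne
    refine ENNReal.eq_sub_of_add_eq hst ?_
    rw [add_comm, ← add_assoc, add_tsub_cancel_of_le h]
  rw [Measure.add_apply, hbu] at hm
  rw [Measure.add_apply, Measure.add_apply, hau, hbu] at hmass
  rw [wPrime_rpow hp, toCompletion_eq_withPoint, toCompletion_eq_withPoint, hμc, hνc]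
  refine (transportCost_le_lintegral (q := pointedPlan (r₁ + r₂) a b (1 - (μ Y + b univ)))
    ?_ ?_).trans ?_
  · rw [fst_pointedPlan, Measure.fst_add, rest _ _ hμ.apply_le_one hm]
  · rw [snd_pointedPlan, Measure.snd_add, hmass,
      rest _ _ hν.apply_le_one (hmass ▸ hm)]
  · rw [lintegral_dPrime_pointedPlan hp0, lintegral_add_measure, hme.lintegral_map,
      hme.lintegral_map]
    gcongr
    · exact min_le_left _ _
    · exact min_le_right _ _

theorem wPrime_rpow_le_decomposition (hY : MeasurableSet Y) (hp : 1 ≤ p)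
    {μ₁ μ₂ μ₀ ν₁ ν₂ ν₀ : Measure X} (hμ : IsSubprob Y μ) (hν : IsSubprob Y ν)
    (hμ' : μ = μ₁ + μ₂ + μ₀) (hν' : ν = ν₁ + ν₂ + ν₀) (hm : (μ + ν₀) Y ≤ 1) :
    WPrime p Y μ ν ^ p ≤ W p μ₁ ν₁ ^ p + WDagger p Y μ₂ ν₂ ^ p +
      ∫⁻ x, dBdry Y x ^ p ∂μ₀ + ∫⁻ x, dBdry Y x ^ p ∂ν₀ := by
  rw [W, WDagger, transportDist_rpow hp, transportDist_rpow hp]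
  simp only [transportCost_eq_iInf, ENNReal.iInf_add, ENNReal.add_iInf]
  exact le_iInf fun q₂ => le_iInf fun q₁ =>
    wPrime_rpow_le_of_plans hY hp hμ hν hμ' hν' hm q₁.2.1 q₁.2.2 q₂.2.1 q₂.2.2

theorem wPrime_rpow_eq (hY : MeasurableSet Y) (hne : Y.Nonempty) (hp : 1 ≤ p)
    (hμ : IsSubprob Y μ) (hν : IsSubprob Y ν) :
    WPrime p Y μ ν ^ p =
      ⨅ (μ₁ : Measure X) (μ₂ : Measure X) (μ₀ : Measure X)
        (ν₁ : Measure X) (ν₂ : Measure X) (ν₀ : Measure X)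
        (_ : μ = μ₁ + μ₂ + μ₀) (_ : ν = ν₁ + ν₂ + ν₀)
        (_ : (μ + ν₀) Y ≤ 1) (_ : (ν + μ₀) Y ≤ 1),
        W p μ₁ ν₁ ^ p + WDagger p Y μ₂ ν₂ ^ p + WPrime p Y μ₀ 0 ^ p + WPrime p Y ν₀ 0 ^ p := by
  have : Nonempty Y := hne.to_subtype
  have hp0 : 0 < p := by linarith
  apply le_antisymm
  · refine le_iInf fun μ₁ => le_iInf fun μ₂ => le_iInf fun μ₀ => le_iInf fun ν₁ =>
      le_iInf fun ν₂ => le_iInf fun ν₀ => le_iInf fun h₁ => le_iInf fun h₂ => le_iInf fun h₃ =>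
      le_iInf fun h₄ => ?_
    rw [wPrime_zero_rpow' hY hne hp (hμ.of_add_right h₁),
      wPrime_zero_rpow' hY hne hp (hν.of_add_right h₂)]
    exact wPrime_rpow_le_decomposition hY hp hμ hν h₁ h₂ h₃
  · rw [wPrime_rpow hp]
    refine le_iInf fun Q => le_iInf fun h₁ => le_iInf fun h₂ => ?_
    obtain ⟨q, a, b, m, rfl⟩ := exists_eq_pointedPlan Q
    rw [fst_pointedPlan, toCompletion_eq_withPoint, withPoint_inj] at h₁
    rw [snd_pointedPlan, toCompletion_eq_withPoint, withPoint_inj] at h₂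
    have hme := MeasurableEmbedding.subtype_coe hY
    have hpm : Measurable (Prod.map Subtype.val Subtype.val : Y × Y → X × X) := by fun_prop
    -- On `S` the minimum in `d'` is `d`, off `S` it is `d†`; the two restrictions of `q` produce
    -- the parts with indices `1` and `2`.
    let S : Set (Y × Y) := {z | edist (z.1 : X) z.2 ≤ dDagger Y z.1 z.2}
    have hb : Measurable fun y : Y => dBdry Y y := measurable_dBdry.comp measurable_subtype_coe
    have hS : MeasurableSet S := by
      refine measurableSet_le ?_ ((hb.comp measurable_fst).add (hb.comp measurable_snd))
      exact measurable_edist_prod.comp hpm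
    have hq : q.restrict S + q.restrict Sᶜ = q := Measure.restrict_add_restrict_compl hS
    let V : Measure (Y × Y) → Measure (X × X) := fun r => r.map (Prod.map Subtype.val Subtype.val)
    have hμd : μ = (V (q.restrict S)).fst + (V (q.restrict Sᶜ)).fst + a.map Subtype.val := by
      rw [fst_map_prodMap_val, fst_map_prodMap_val, ← Measure.map_add _ _ hme.measurable,
        ← Measure.map_add _ _ hme.measurable, ← Measure.fst_add, hq, h₁.1, map_comap_val hY hμ.1]
    have hνd : ν = (V (q.restrict S)).snd + (V (q.restrict Sᶜ)).snd + b.map Subtype.val := by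
      rw [snd_map_prodMap_val, snd_map_prodMap_val, ← Measure.map_add _ _ hme.measurable,
        ← Measure.map_add _ _ hme.measurable, ← Measure.snd_add, hq, h₂.1, map_comap_val hY hν.1]
    have hau : (a.map (Subtype.val : Y → X)) Y = a univ := by
      rw [Measure.map_apply hme.measurable hY]; simp
    have hbu : (b.map (Subtype.val : Y → X)) Y = b univ := by
      rw [Measure.map_apply hme.measurable hY]; simp
    refine iInf_le_of_le _ <| iInf_le_of_le _ <| iInf_le_of_le _ <| iInf_le_of_le _ <|
      iInf_le_of_le _ <| iInf_le_of_le _ <| iInf_le_of_le hμd <| iInf_le_of_le hνd <|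
      iInf_le_of_le ?_ <| iInf_le_of_le ?_ ?_
    · rw [Measure.add_apply, hbu, ← add_tsub_cancel_of_le hμ.apply_le_one, ← h₁.2]
      gcongr
      exact le_self_add
    · rw [Measure.add_apply, hau, ← add_tsub_cancel_of_le hν.apply_le_one, ← h₂.2]
      gcongr
      exact le_self_add
    · rw [wPrime_zero_rpow' hY hne hp (hμ.of_add_right hμd),
        wPrime_zero_rpow' hY hne hp (hν.of_add_right hνd), lintegral_dPrime_pointedPlan hp0,
        hme.lintegral_map, hme.lintegral_map, W, WDagger, transportDist_rpow hp,
        transportDist_rpow hp]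
      conv_rhs => rw [← lintegral_add_compl _ hS]
      gcongr
      · refine (transportCost_le_lintegral rfl rfl).trans_eq ?_
        rw [lintegral_map_prodMap_val hY]
        refine setLIntegral_congr_fun hS fun z hz => ?_
        rw [min_eq_left hz]
      · refine (transportCost_le_lintegral rfl rfl).trans_eq ?_
        rw [lintegral_map_prodMap_val hY]
        refine setLIntegral_congr_fun hS.compl fun z hz => ?_
        have hz' : ¬ edist (z.1 : X) z.2 ≤ dDagger Y z.1 z.2 := hz
        rw [min_eq_right (not_le.1 hz').le]

end Shortcut

/-! ### The case `p = 1` of `W'_p` -/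

section PEqOne

variable {X : Type*} [MetricSpace X] {Y : Set X} [MeasurableSpace X] {μ ν ρ : Measure X}

/-- The right-hand side of the formula for `W♯₁`. -/
noncomputable def freeCost (Y : Set X) (μ ν : Measure X) : ℝ≥0∞ :=
  ⨅ (μ₁ : Measure X) (μ₀ : Measure X) (ν₁ : Measure X) (ν₀ : Measure X)
    (_ : μ = μ₁ + μ₀) (_ : ν = ν₁ + ν₀),
    W 1 μ₁ ν₁ + annihilationCost 1 Y μ₀ + annihilationCost 1 Y ν₀

theorem transportDist_zero_zero {α : Type*} [MeasurableSpace α] (c : α → α → ℝ≥0∞) :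
    transportDist c 1 (0 : Measure α) 0 = 0 := by
  rw [transportDist_one]
  refine le_antisymm ?_ zero_le
  exact (transportCost_le_lintegral (q := 0) (by simp) (by simp)).trans_eq (by simp)

theorem transportDist_edist_self (μ : Measure X) : transportDist edist 1 μ μ = 0 := by
  rw [transportDist_one]
  refine le_antisymm ?_ zero_le
  refine (transportCost_le_lintegral (fst_map_diag μ) (snd_map_diag μ)).trans ?_
  exact (lintegral_map_diag_le _ _).trans_eq (by simp)

variable [BorelSpace X]

theorem wDagger_one_ge : ∫⁻ x, dBdry Y x ∂μ + ∫⁻ x, dBdry Y x ∂ν ≤ WDagger 1 Y μ ν := by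
  rw [WDagger, transportDist_one]
  refine le_iInf fun q => le_iInf fun h₁ => le_iInf fun h₂ => ?_
  rw [← h₁, ← h₂, lintegral_fst_add_snd measurable_dBdry]
  simp only [ENNReal.rpow_one]
  exact le_rfl

variable [SecondCountableTopology X]

theorem wPrime_one_le_of_add (hY : MeasurableSet Y) {μ₁ μ₀ ν₁ ν₀ : Measure X}
    (hμ : IsSubprob Y μ) (hν : IsSubprob Y ν) (hμ' : μ = μ₁ + μ₀) (hν' : ν = ν₁ + ν₀)
    (hm : (μ + ν₀) Y ≤ 1) :
    WPrime 1 Y μ ν ≤ W 1 μ₁ ν₁ + annihilationCost 1 Y μ₀ + annihilationCost 1 Y ν₀ := by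
  have := wPrime_rpow_le_decomposition (μ₁ := μ₁) (μ₂ := 0) (μ₀ := μ₀) (ν₁ := ν₁) (ν₂ := 0)
    (ν₀ := ν₀) hY le_rfl hμ hν
    (hμ'.trans (by rw [add_zero])) (hν'.trans (by rw [add_zero])) hm
  simpa [WDagger, transportDist_zero_zero, annihilationCost_one] using this

variable [StandardBorelSpace X]

theorem wPrime_one_triangle (hY : MeasurableSet Y) (hne : Y.Nonempty) (hμ : IsSubprob Y μ)
    (hν : IsSubprob Y ν) :
    WPrime 1 Y μ ρ ≤ WPrime 1 Y μ ν + WPrime 1 Y ν ρ := by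
  have : Nonempty Y := hne.to_subtype
  have : StandardBorelSpace Y := hY.standardBorel
  have := isProbabilityMeasure_toCompletion hY hμ
  have := isProbabilityMeasure_toCompletion hY hν
  simp only [WPrime, transportDist_one]
  rw [transportCost_eq_iInf (μ := toCompletion Y μ) (ν := toCompletion Y ν),
    transportCost_eq_iInf (μ := toCompletion Y ν)]
  simp only [ENNReal.iInf_add, ENNReal.add_iInf]
  refine le_iInf fun ⟨q₂, h₂, h₂'⟩ => le_iInf fun ⟨q₁, h₁, h₁'⟩ => ?_
  have : IsFiniteMeasure q₁ := have : IsFiniteMeasure q₁.fst := h₁ ▸ inferInstance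
    isFiniteMeasure_of_fst
  have : IsFiniteMeasure q₂ := have : IsFiniteMeasure q₂.fst := h₂ ▸ inferInstance
    isFiniteMeasure_of_fst
  obtain ⟨q, hq, hq', hc⟩ := exists_composition (h₁'.trans h₂.symm)
    (c := fun z => dPrime Y z.1 z.2) (c₁ := fun z => dPrime Y z.1 z.2)
    (c₂ := fun z => dPrime Y z.1 z.2) measurable_dPrime measurable_dPrime
    (ae_of_all _ fun y x z => dPrime_triangle x y z)
  simp only [ENNReal.rpow_one]
  refine (transportCost_le_lintegral (hq.trans h₁) (hq'.trans h₂')).trans ?_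
  simpa only [ENNReal.rpow_one] using hc

/-- Along the chain `μ, μ₁, ν₁, ν` mass is killed before it is created, so each step meets the mass
constraint by itself. Conversely, `W†₁` is at least the cost of killing `μ₂` and creating `ν₂`. -/
theorem wPrime_one_eq_freeCost (hY : MeasurableSet Y) (hne : Y.Nonempty) (hμ : IsSubprob Y μ)
    (hν : IsSubprob Y ν) : WPrime 1 Y μ ν = freeCost Y μ ν := by
  apply le_antisymm
  · refine le_iInf fun μ₁ => le_iInf fun μ₀ => le_iInf fun ν₁ => le_iInf fun ν₀ =>
      le_iInf fun h₁ => le_iInf fun h₂ => ?_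
    have hμ₁ := hμ.of_add_left h₁
    have hν₁ := hν.of_add_left h₂
    have e₀ : annihilationCost 1 Y (0 : Measure X) = 0 := by simp [annihilationCost_one]
    have t₁ := wPrime_one_le_of_add (ν₀ := 0) hY hμ hμ₁ h₁ (add_zero μ₁).symm
      (by simpa using hμ.apply_le_one)
    have t₂ := wPrime_one_le_of_add (μ₀ := 0) (ν₀ := 0) hY hμ₁ hν₁ (add_zero μ₁).symm
      (add_zero ν₁).symm (by simpa using hμ₁.apply_le_one)
    have t₃ := wPrime_one_le_of_add (μ₀ := 0) hY hν₁ hν (add_zero ν₁).symm h₂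
      (by rw [← h₂]; exact hν.apply_le_one)
    simp only [W, transportDist_edist_self, e₀, add_zero, zero_add] at t₁ t₂ t₃
    calc WPrime 1 Y μ ν ≤ WPrime 1 Y μ μ₁ + (WPrime 1 Y μ₁ ν₁ + WPrime 1 Y ν₁ ν) :=
          (wPrime_one_triangle hY hne hμ hμ₁).trans
            (by gcongr; exact wPrime_one_triangle hY hne hμ₁ hν₁)
      _ ≤ annihilationCost 1 Y μ₀ + (W 1 μ₁ ν₁ + annihilationCost 1 Y ν₀) := by
          gcongr
          exact t₂
      _ = _ := by ring
  · have h := wPrime_rpow_eq hY hne le_rfl hμ hν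
    rw [ENNReal.rpow_one] at h
    rw [h]
    refine le_iInf fun μ₁ => le_iInf fun μ₂ => le_iInf fun μ₀ => le_iInf fun ν₁ =>
      le_iInf fun ν₂ => le_iInf fun ν₀ => le_iInf fun h₁ => le_iInf fun h₂ => le_iInf fun h₃ =>
      le_iInf fun h₄ => ?_
    simp only [ENNReal.rpow_one]
    rw [wPrime_zero_one hY hne (hμ.of_add_right h₁), wPrime_zero_one hY hne (hν.of_add_right h₂)]
    refine iInf_le_of_le μ₁ <| iInf_le_of_le (μ₂ + μ₀) <| iInf_le_of_le ν₁ <|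
      iInf_le_of_le (ν₂ + ν₀) <| iInf_le_of_le (by rw [h₁, add_assoc]) <|
      iInf_le_of_le (by rw [h₂, add_assoc]) ?_
    simp only [annihilationCost_one, lintegral_add_measure]
    calc _ = W 1 μ₁ ν₁ + (∫⁻ x, dBdry Y x ∂μ₂ + ∫⁻ x, dBdry Y x ∂ν₂) + ∫⁻ x, dBdry Y x ∂μ₀ +
          ∫⁻ x, dBdry Y x ∂ν₀ := by ring
      _ ≤ _ := by
        gcongr
        exact wDagger_one_ge

end PEqOne

/-! ### Linear interpolation for `W₁` -/

section Symmetry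

variable {X : Type*} [MetricSpace X] [MeasurableSpace X] {μ ν : Measure X}

theorem W_one_comm : W 1 μ ν = W 1 ν μ := by
  have key : ∀ μ ν : Measure X, W 1 μ ν ≤ W 1 ν μ := by
    intro μ ν
    rw [W, W, transportDist_one, transportDist_one]
    refine le_iInf fun q => le_iInf fun h₁ => le_iInf fun h₂ => ?_
    refine (transportCost_le_lintegral (q := q.map Prod.swap) ?_ ?_).trans ?_
    · rw [Measure.fst_map_swap, h₂]
    · rw [Measure.snd_map_swap, h₁]
    · exact lintegral_map_swap_le (fun x y => by simp only [edist_comm]) q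
  exact le_antisymm (key _ _) (key _ _)

/-- The common part `κ` stays at rest on the diagonal, at no cost. -/
theorem W_one_add_smul_le (κ : Measure X) {r : ℝ≥0∞} (hr : r ≠ ∞) :
    W 1 (κ + r • μ) (κ + r • ν) ≤ r * W 1 μ ν := by
  rcases eq_or_ne r 0 with rfl | hr0
  · simp [W, transportDist_edist_self]
  rw [W, W, transportDist_one, transportDist_one, transportCost_eq_iInf (μ := μ),
    ENNReal.mul_iInf_of_ne hr0 hr]
  refine le_iInf fun q => ?_
  refine (transportCost_le_lintegral (q := κ.map (fun x => (x, x)) + r • q.1) ?_ ?_).trans ?_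
  · rw [Measure.fst_add, fst_map_diag, Measure.fst, Measure.map_smul, ← Measure.fst, q.2.1]
  · rw [Measure.snd_add, snd_map_diag, Measure.snd, Measure.map_smul, ← Measure.snd, q.2.2]
  · rw [lintegral_add_measure, lintegral_smul_measure, smul_eq_mul]
    refine (add_le_add_left (lintegral_map_diag_le _ _) _).trans_eq ?_
    simp

end Symmetry

section LinearCurve

theorem sum_sub_castSucc {n : ℕ} (f : Fin (n + 1) → ℝ) :
    ∑ i : Fin n, (f i.succ - f i.castSucc) = f (Fin.last n) - f 0 := by
  induction n with
  | zero => simp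
  | succ n ih =>
    rw [Fin.sum_univ_castSucc]
    have := ih fun i => f i.castSucc
    simp only [Fin.castSucc_zero] at this
    simp only [Fin.succ_castSucc, this, Fin.succ_last]
    ring

variable {X : Type*} [MeasurableSpace X]

/-- The linear interpolation of two measures. -/
noncomputable def linearCurve (μ ν : Measure X) (t : unitInterval) : Measure X :=
  ENNReal.ofReal (1 - t) • μ + ENNReal.ofReal t • ν

/-- Between the times `s` and `t` only the portion `t - s` of `μ` is exchanged for the same portion
of `ν`. With costs that are linear in the mass, this makes the curve Lipschitz with the
decomposition cost as its constant. -/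
theorem exists_linearCurve_eq (μ ν : Measure X) {s t : unitInterval} (h : s ≤ t) :
    ∃ κ : Measure X, linearCurve μ ν s = κ + ENNReal.ofReal (t - s) • μ ∧
      linearCurve μ ν t = κ + ENNReal.ofReal (t - s) • ν := by
  have h' : (s : ℝ) ≤ t := h
  have hs := s.2.1
  have ht := t.2.2
  refine ⟨ENNReal.ofReal (1 - t) • μ + ENNReal.ofReal s • ν, ?_, ?_⟩
  · have : ENNReal.ofReal (1 - s) = ENNReal.ofReal (1 - t) + ENNReal.ofReal (t - s) := by
      rw [← ENNReal.ofReal_add (by linarith) (by linarith)]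
      congr 1
      ring
    rw [linearCurve, this, add_smul]
    abel
  · have : ENNReal.ofReal t = ENNReal.ofReal s + ENNReal.ofReal (t - s) := by
      rw [← ENNReal.ofReal_add hs (by linarith)]
      congr 1
      ring
    rw [linearCurve, this, add_smul]
    abel

end LinearCurve

/-! ### Chains, curves and the formula for `W♯₁` -/

section Curves

variable {X : Type*} [MetricSpace X] {Y : Set X} [MeasurableSpace X] {μ ν : Measure X}

theorem wFlat_le_of_chain {μ' ν' : Measure X} (hμ : IsSubprobP 1 Y μ) (hμ' : IsSubprobP 1 Y μ')
    (hν' : IsSubprobP 1 Y ν') (hν : IsSubprobP 1 Y ν) :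
    WFlat 1 Y μ ν ≤ WZero 1 Y μ μ' + WZero 1 Y μ' ν' + WZero 1 Y ν' ν := by
  refine iInf_le_of_le 3 <| iInf_le_of_le ![μ, μ', ν', ν] <| iInf_le_of_le ?_ <|
    iInf_le_of_le rfl <| iInf_le_of_le rfl ?_
  · intro i
    fin_cases i
    exacts [hμ, hμ', hν', hν]
  · rw [Fin.sum_univ_three]
    rfl

theorem freeCost_le_constrainedCost : freeCost Y μ ν ≤ constrainedCost Y μ ν := by
  refine le_iInf fun μ₁ => le_iInf fun μ₀ => le_iInf fun ν₁ => le_iInf fun ν₀ =>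
    le_iInf fun h₁ => le_iInf fun h₂ => le_iInf fun _ => le_iInf fun _ => ?_
  exact iInf_le_of_le μ₁ <| iInf_le_of_le μ₀ <| iInf_le_of_le ν₁ <| iInf_le_of_le ν₀ <|
    iInf_le_of_le h₁ <| iInf_le_of_le h₂ le_rfl

variable [BorelSpace X]

theorem annihilationCost_one_smul (r : ℝ≥0∞) :
    annihilationCost 1 Y (r • μ) = r * annihilationCost 1 Y μ := by
  rw [annihilationCost_one, annihilationCost_one, lintegral_smul_measure, smul_eq_mul]

variable [SecondCountableTopology X]

/-- All of `μ` moves to `o` and the missing mass is created there, both at finite cost. Together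
with `IsSubprobP.exists_lintegral_edist_lt` this identifies the class for `p = 1` by finite first
moments, which makes it stable under convex combinations and smaller measures. -/
theorem IsSubprob.isSubprobP_one (hX : IsLengthSpace X) (hYo : IsOpen Y) (hYu : Y ≠ univ)
    (hμ : IsSubprob Y μ) {o : X} (ho : o ∈ Y) (h : ∫⁻ x, edist x o ∂μ < ∞) :
    IsSubprobP 1 Y μ := by
  refine ⟨hμ, o, ho, ?_⟩
  have hd : IsSubprob Y (Measure.dirac o) := by
    refine ⟨?_, by simp⟩
    rw [Measure.dirac_apply' _ hYo.measurableSet.compl]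
    simp [ho]
  have hle := wZero_rpow_le_decomposition hX hYo hYu le_rfl (μ₁ := μ) (μ₀ := 0)
    (ν₁ := μ univ • Measure.dirac o) (ν₀ := (1 - μ univ) • Measure.dirac o) hμ hd
    (add_zero μ).symm (by rw [← add_smul, add_tsub_cancel_of_le hμ.2, one_smul])
    (by simp [add_tsub_cancel_of_le hμ.2])
  simp only [ENNReal.rpow_one] at hle
  refine hle.trans_lt (ENNReal.add_lt_top.2 ⟨ENNReal.add_lt_top.2 ⟨?_, ?_⟩, ?_⟩)
  · rw [W, transportDist_one]
    refine (transportCost_le_lintegral (q := μ.map fun x => (x, o)) ?_ ?_).trans_lt ?_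
    · rw [Measure.fst_map_prodMk measurable_const, Measure.map_id']
    · rw [Measure.snd_map_prodMk measurable_id', Measure.map_const]
    · refine (lintegral_map_le _ _).trans_lt ?_
      simpa using h
  · simp [annihilationCost_one]
  · rw [annihilationCost_one, lintegral_smul_measure, lintegral_dirac' _ measurable_dBdry,
      smul_eq_mul]
    exact ENNReal.mul_lt_top (tsub_le_self.trans_lt ENNReal.one_lt_top)
      (dBdry_ne_top hYu o).lt_top

theorem IsSubprobP.of_add_left (hX : IsLengthSpace X) (hYo : IsOpen Y) (hYu : Y ≠ univ)
    (hμ : IsSubprobP 1 Y μ) {a b : Measure X} (h : μ = a + b) : IsSubprobP 1 Y a := by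
  obtain ⟨o, ho, hm⟩ := hμ.exists_lintegral_edist_lt
  refine (hμ.1.of_add_left h).isSubprobP_one hX hYo hYu ho (lt_of_le_of_lt ?_ hm)
  exact lintegral_mono' (h ▸ Measure.le_add_right le_rfl) le_rfl

theorem IsSubprobP.convex_comb (hX : IsLengthSpace X) (hYo : IsOpen Y) (hYu : Y ≠ univ)
    (hμ : IsSubprobP 1 Y μ) (hν : IsSubprobP 1 Y ν) {s t : ℝ≥0∞} (h : s + t = 1) :
    IsSubprobP 1 Y (s • μ + t • ν) := by
  have := hν.1.isFiniteMeasure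
  obtain ⟨o, ho, hm⟩ := hμ.exists_lintegral_edist_lt
  obtain ⟨o', -, hn⟩ := hν.exists_lintegral_edist_lt
  replace hn := lintegral_edist_lt_top hn o
  have hs : s < ∞ := (le_self_add.trans h.le).trans_lt ENNReal.one_lt_top
  have ht : t < ∞ := (le_add_self.trans h.le).trans_lt ENNReal.one_lt_top
  refine IsSubprob.isSubprobP_one hX hYo hYu ⟨?_, ?_⟩ ho ?_
  · simp [hμ.1.1, hν.1.1]
  · rw [Measure.add_apply, Measure.smul_apply, Measure.smul_apply, smul_eq_mul, smul_eq_mul, ← h]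
    exact add_le_add (mul_le_of_le_one_right' hμ.1.2) (mul_le_of_le_one_right' hν.1.2)
  · rw [lintegral_add_measure, lintegral_smul_measure, lintegral_smul_measure]
    exact ENNReal.add_lt_top.2 ⟨ENNReal.mul_lt_top hs hm, ENNReal.mul_lt_top ht hn⟩

/-- Chains remove the mass constraints of `W⁰₁`: along `μ, μ₁, ν₁, ν` no intermediate total mass
exceeds one. -/
theorem wFlat_le (hX : IsLengthSpace X) (hYo : IsOpen Y) (hYu : Y ≠ univ)
    (hμ : IsSubprobP 1 Y μ) (hν : IsSubprobP 1 Y ν) {μ₁ μ₀ ν₁ ν₀ : Measure X}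
    (h₁ : μ = μ₁ + μ₀) (h₂ : ν = ν₁ + ν₀) :
    WFlat 1 Y μ ν ≤ W 1 μ₁ ν₁ + annihilationCost 1 Y μ₀ + annihilationCost 1 Y ν₀ := by
  have hμ₁ := hμ.of_add_left hX hYo hYu h₁
  have hν₁ := hν.of_add_left hX hYo hYu h₂
  have e₀ : annihilationCost 1 Y (0 : Measure X) = 0 := by simp [annihilationCost_one]
  have t₁ := wZero_rpow_le_decomposition (ν₀ := 0) hX hYo hYu le_rfl hμ.1 hμ₁.1 h₁
    (add_zero μ₁).symm (by simpa using hμ.1.2)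
  have t₂ := wZero_rpow_le_decomposition (μ₀ := 0) (ν₀ := 0) hX hYo hYu le_rfl hμ₁.1 hν₁.1
    (add_zero μ₁).symm (add_zero ν₁).symm (by simpa using hμ₁.1.2)
  have t₃ := wZero_rpow_le_decomposition (μ₀ := 0) hX hYo hYu le_rfl hν₁.1 hν.1
    (add_zero ν₁).symm h₂ (by rw [← h₂]; exact hν.1.2)
  simp only [W, transportDist_edist_self, e₀, add_zero, zero_add, ENNReal.rpow_one] at t₁ t₂ t₃
  calc _ ≤ _ := wFlat_le_of_chain hμ hμ₁ hν₁ hν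
    _ ≤ annihilationCost 1 Y μ₀ + W 1 μ₁ ν₁ + annihilationCost 1 Y ν₀ := by
      gcongr
      exact t₂
    _ = _ := by ring

theorem wFlat_add_smul_le (hX : IsLengthSpace X) (hYo : IsOpen Y) (hYu : Y ≠ univ)
    {μ₁ μ₀ ν₁ ν₀ κ : Measure X} {r : ℝ≥0∞} (hr : r ≠ ∞)
    (hμ : IsSubprobP 1 Y (κ + r • (μ₁ + μ₀))) (hν : IsSubprobP 1 Y (κ + r • (ν₁ + ν₀))) :
    WFlat 1 Y (κ + r • (μ₁ + μ₀)) (κ + r • (ν₁ + ν₀)) ≤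
      r * (W 1 μ₁ ν₁ + annihilationCost 1 Y μ₀ + annihilationCost 1 Y ν₀) := by
  refine (wFlat_le hX hYo hYu hμ hν (μ₁ := κ + r • μ₁) (μ₀ := r • μ₀) (ν₁ := κ + r • ν₁)
    (ν₀ := r • ν₀) (by rw [smul_add, add_assoc]) (by rw [smul_add, add_assoc])).trans ?_
  rw [annihilationCost_one_smul, annihilationCost_one_smul, mul_add, mul_add]
  gcongr
  exact W_one_add_smul_le κ hr

theorem isSubprobP_linearCurve (hX : IsLengthSpace X) (hYo : IsOpen Y) (hYu : Y ≠ univ)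
    (hμ : IsSubprobP 1 Y μ) (hν : IsSubprobP 1 Y ν) (t : unitInterval) :
    IsSubprobP 1 Y (linearCurve μ ν t) := by
  refine hμ.convex_comb hX hYo hYu hν ?_
  rw [← ENNReal.ofReal_add (by linarith [t.2.2]) t.2.1]
  simp

theorem wFlat_linearCurve_le (hX : IsLengthSpace X) (hYo : IsOpen Y) (hYu : Y ≠ univ)
    {μ₁ μ₀ ν₁ ν₀ : Measure X} (hμ : IsSubprobP 1 Y (μ₁ + μ₀)) (hν : IsSubprobP 1 Y (ν₁ + ν₀))
    (s t : unitInterval) :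
    WFlat 1 Y (linearCurve (μ₁ + μ₀) (ν₁ + ν₀) s) (linearCurve (μ₁ + μ₀) (ν₁ + ν₀) t) ≤
      ENNReal.ofReal |(t : ℝ) - s| *
        (W 1 μ₁ ν₁ + annihilationCost 1 Y μ₀ + annihilationCost 1 Y ν₀) := by
  have hp := isSubprobP_linearCurve hX hYo hYu hμ hν
  have hs := hp s
  have ht := hp t
  rcases le_total s t with h | h
  · have h' : (s : ℝ) ≤ t := h
    obtain ⟨κ, e₁, e₂⟩ := exists_linearCurve_eq (μ₁ + μ₀) (ν₁ + ν₀) h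
    rw [e₁] at hs ⊢
    rw [e₂] at ht ⊢
    rw [abs_of_nonneg (by linarith)]
    exact wFlat_add_smul_le hX hYo hYu ENNReal.ofReal_ne_top hs ht
  · have h' : (t : ℝ) ≤ s := h
    obtain ⟨κ, e₁, e₂⟩ := exists_linearCurve_eq (μ₁ + μ₀) (ν₁ + ν₀) h
    rw [e₂] at hs ⊢
    rw [e₁] at ht ⊢
    rw [abs_sub_comm, abs_of_nonneg (by linarith), W_one_comm, add_right_comm]
    exact wFlat_add_smul_le hX hYo hYu ENNReal.ofReal_ne_top hs ht

theorem flatLength_linearCurve_le (hX : IsLengthSpace X) (hYo : IsOpen Y) (hYu : Y ≠ univ)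
    {μ₁ μ₀ ν₁ ν₀ : Measure X} (hμ : IsSubprobP 1 Y (μ₁ + μ₀)) (hν : IsSubprobP 1 Y (ν₁ + ν₀)) :
    flatLength 1 Y (linearCurve (μ₁ + μ₀) (ν₁ + ν₀)) ≤
      W 1 μ₁ ν₁ + annihilationCost 1 Y μ₀ + annihilationCost 1 Y ν₀ := by
  refine iSup_le fun n => iSup_le fun s => iSup_le fun hs => iSup_le fun h0 => iSup_le fun h1 => ?_
  have hmono : ∀ i : Fin n, (s i.castSucc : ℝ) ≤ s i.succ := fun i =>
    (hs i.castSucc_lt_succ).le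
  calc _ ≤ ∑ i : Fin n, ENNReal.ofReal ((s i.succ : ℝ) - s i.castSucc) *
        (W 1 μ₁ ν₁ + annihilationCost 1 Y μ₀ + annihilationCost 1 Y ν₀) := by
        refine Finset.sum_le_sum fun i _ => ?_
        have := wFlat_linearCurve_le hX hYo hYu hμ hν (s i.castSucc) (s i.succ)
        rwa [abs_of_nonneg (by linarith [hmono i])] at this
    _ = _ := by
        rw [← Finset.sum_mul, ← ENNReal.ofReal_sum_of_nonneg fun i _ => by linarith [hmono i],
          sum_sub_castSucc fun i => (s i : ℝ), h0, h1]
        simp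

theorem wSharp_le_freeCost (hX : IsLengthSpace X) (hYo : IsOpen Y) (hYu : Y ≠ univ)
    (hμ : IsSubprobP 1 Y μ) (hν : IsSubprobP 1 Y ν) : WSharp 1 Y μ ν ≤ freeCost Y μ ν := by
  refine le_iInf fun μ₁ => le_iInf fun μ₀ => le_iInf fun ν₁ => le_iInf fun ν₀ =>
    le_iInf fun h₁ => le_iInf fun h₂ => ?_
  subst h₁ h₂
  -- The Lipschitz bound gives continuity of the linear curve only for a finite constant; an
  -- infinite one makes the claim trivial.
  rcases eq_or_ne (W 1 μ₁ ν₁ + annihilationCost 1 Y μ₀ + annihilationCost 1 Y ν₀) ∞ with hK | hK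
  · rw [hK]
    exact le_top
  refine iInf_le_of_le (linearCurve (μ₁ + μ₀) (ν₁ + ν₀)) <|
    iInf_le_of_le (isSubprobP_linearCurve hX hYo hYu hμ hν) <| iInf_le_of_le ?_ <|
    iInf_le_of_le ?_ <| iInf_le_of_le ?_ (flatLength_linearCurve_le hX hYo hYu hμ hν)
  · intro s
    have hlim : Tendsto (fun t : unitInterval => ENNReal.ofReal |(t : ℝ) - s| *
        (W 1 μ₁ ν₁ + annihilationCost 1 Y μ₀ + annihilationCost 1 Y ν₀)) (𝓝 s) (𝓝 0) := by
      have hc : Continuous fun t : unitInterval => ENNReal.ofReal |(t : ℝ) - s| :=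
        ENNReal.continuous_ofReal.comp (by fun_prop)
      have h0 := hc.tendsto s
      simp only [sub_self, abs_zero, ENNReal.ofReal_zero] at h0
      have := ENNReal.Tendsto.mul_const h0 (Or.inr hK)
      rwa [zero_mul] at this
    exact tendsto_of_tendsto_of_tendsto_of_le_of_le tendsto_const_nhds hlim (fun _ => zero_le)
      fun t => wFlat_linearCurve_le hX hYo hYu hμ hν s t
  · simp [linearCurve]
  · simp [linearCurve]

theorem wPrime_one_self (hY : MeasurableSet Y) (hμ : IsSubprob Y μ) : WPrime 1 Y μ μ = 0 := by
  have := wPrime_one_le_of_add (μ₀ := 0) (ν₀ := 0) hY hμ hμ (add_zero μ).symm (add_zero μ).symm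
    (by simpa using hμ.apply_le_one)
  simpa [W, transportDist_edist_self, annihilationCost_one] using this

variable [StandardBorelSpace X]

/-- Dropping the mass constraints only lowers the infimum, and the unconstrained infimum is `W'₁`.
As `W'₁` also satisfies the triangle inequality, it then bounds chains and lengths of curves from
below. -/
theorem wPrime_one_le_wZero (hYo : IsOpen Y) (hne : Y.Nonempty) (hYu : Y ≠ univ)
    (hμ : IsSubprobP 1 Y μ) (hν : IsSubprobP 1 Y ν) : WPrime 1 Y μ ν ≤ WZero 1 Y μ ν := by
  rw [wPrime_one_eq_freeCost hYo.measurableSet hne hμ.1 hν.1]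
  exact freeCost_le_constrainedCost.trans (constrainedCost_le_wZero hYu hμ hν)

theorem wPrime_one_le_wFlat (hYo : IsOpen Y) (hne : Y.Nonempty) (hYu : Y ≠ univ) :
    WPrime 1 Y μ ν ≤ WFlat 1 Y μ ν := by
  refine le_iInf fun n => le_iInf fun η => le_iInf fun hη => le_iInf fun h0 => le_iInf fun h1 => ?_
  subst h0 h1
  induction n with
  | zero => exact (wPrime_one_self hYo.measurableSet (hη 0).1).trans_le zero_le
  | succ n ih =>
    rw [Fin.sum_univ_castSucc]
    have h := ih (fun i => η i.castSucc) fun i => hη _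
    refine (wPrime_one_triangle hYo.measurableSet hne (hη 0).1
      (hη (Fin.last n).castSucc).1).trans ?_
    refine add_le_add h ?_
    exact wPrime_one_le_wZero hYo hne hYu (hη _) (hη _)

theorem wPrime_one_le_wSharp (hYo : IsOpen Y) (hne : Y.Nonempty) (hYu : Y ≠ univ) :
    WPrime 1 Y μ ν ≤ WSharp 1 Y μ ν := by
  refine le_iInf fun η => le_iInf fun _ => le_iInf fun _ => le_iInf fun h0 => le_iInf fun h1 => ?_
  refine (wPrime_one_le_wFlat hYo hne hYu).trans ?_
  -- The trivial partition `0 < 1` suffices: a length is at least the distance of the end points.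
  refine le_iSup_of_le 1 <| le_iSup_of_le ![0, 1] <| le_iSup_of_le ?_ <| le_iSup_of_le rfl <|
    le_iSup_of_le rfl ?_
  · intro i j hij
    fin_cases i <;> fin_cases j <;> simp_all
  · subst h0 h1
    simp

end Curves

end TransportAnnihilation

open TransportAnnihilation in
theorem lemma1p5 {X : Type*} [MetricSpace X] [CompleteSpace X]
    [TopologicalSpace.SeparableSpace X] [MeasurableSpace X] [BorelSpace X]
    (hX : IsLengthSpace X) (Y : Set X) (hYo : IsOpen Y) (hYne : Y.Nonempty)
    (hYuniv : Y ≠ Set.univ) :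
    -- (i)
    (∀ μ ν : Measure X, IsSubprobP 1 Y μ → IsSubprobP 1 Y ν →
      WZero 1 Y μ ν =
        ⨅ (μ₁ : Measure X) (μ₀ : Measure X) (ν₁ : Measure X) (ν₀ : Measure X)
          (_ : μ = μ₁ + μ₀) (_ : ν = ν₁ + ν₀)
          (_ : (μ + ν₀) Set.univ ≤ 1) (_ : (ν + μ₀) Set.univ ≤ 1),
          W 1 μ₁ ν₁ + annihilationCost 1 Y μ₀ + annihilationCost 1 Y ν₀) ∧
    -- (ii)
    (∀ p : ℝ, 1 ≤ p → ∀ μ ν : Measure X, IsSubprobP p Y μ → IsSubprobP p Y ν →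
      WZero p Y μ ν ^ p ≤
        ⨅ (μ₁ : Measure X) (μ₀ : Measure X) (ν₁ : Measure X) (ν₀ : Measure X)
          (_ : μ = μ₁ + μ₀) (_ : ν = ν₁ + ν₀)
          (_ : (μ + ν₀) Set.univ ≤ 1) (_ : (ν + μ₀) Set.univ ≤ 1),
          W p μ₁ ν₁ ^ p + annihilationCost p Y μ₀ ^ p + annihilationCost p Y ν₀ ^ p) ∧
    -- (iii)
    (∀ μ ν : Measure X, IsSubprobP 1 Y μ → IsSubprobP 1 Y ν →
      WSharp 1 Y μ ν =
        ⨅ (μ₁ : Measure X) (μ₀ : Measure X) (ν₁ : Measure X) (ν₀ : Measure X)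
          (_ : μ = μ₁ + μ₀) (_ : ν = ν₁ + ν₀),
          W 1 μ₁ ν₁ + annihilationCost 1 Y μ₀ + annihilationCost 1 Y ν₀) ∧
    -- (iv), the decomposition
    (∀ p : ℝ, 1 ≤ p → ∀ μ ν : Measure X, IsSubprobP p Y μ → IsSubprobP p Y ν →
      WPrime p Y μ ν ^ p =
        ⨅ (μ₁ : Measure X) (μ₂ : Measure X) (μ₀ : Measure X)
          (ν₁ : Measure X) (ν₂ : Measure X) (ν₀ : Measure X)
          (_ : μ = μ₁ + μ₂ + μ₀) (_ : ν = ν₁ + ν₂ + ν₀)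
          (_ : (μ + ν₀) Y ≤ 1) (_ : (ν + μ₀) Y ≤ 1),
          W p μ₁ ν₁ ^ p + WDagger p Y μ₂ ν₂ ^ p + WPrime p Y μ₀ 0 ^ p + WPrime p Y ν₀ 0 ^ p) ∧
    -- (iv), the cost of transporting everything to the boundary point
    (∀ p : ℝ, 1 ≤ p → ∀ μ₀ : Measure X, IsSubprob Y μ₀ →
      WPrime p Y μ₀ 0 ^ p = ∫⁻ x in Y, dBdry Y x ^ p ∂μ₀) ∧
    -- (iv), the case p = 1
    (∀ μ ν : Measure X, IsSubprobP 1 Y μ → IsSubprobP 1 Y ν →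
      WPrime 1 Y μ ν =
        ⨅ (μ₁ : Measure X) (μ₀ : Measure X) (ν₁ : Measure X) (ν₀ : Measure X)
          (_ : μ = μ₁ + μ₀) (_ : ν = ν₁ + ν₀),
          W 1 μ₁ ν₁ + WPrime 1 Y μ₀ 0 + WPrime 1 Y ν₀ 0) := by
  obtain ⟨o, ho⟩ := hYne
  have : SecondCountableTopology X := UniformSpace.secondCountable_of_separable X
  have : PolishSpace X := inferInstance
  have hY := hYo.measurableSet
  have hne : Y.Nonempty := ⟨o, ho⟩
  refine ⟨fun μ ν hμ hν => le_antisymm ?_ (constrainedCost_le_wZero hYuniv hμ hν),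
    fun p hp μ ν hμ hν => ?_, fun μ ν hμ hν => le_antisymm (wSharp_le_freeCost hX hYo hYuniv hμ hν)
      ((wPrime_one_eq_freeCost hY hne hμ.1 hν.1).symm.trans_le
        (wPrime_one_le_wSharp hYo hne hYuniv)),
    fun p hp μ ν hμ hν => wPrime_rpow_eq hY hne hp hμ.1 hν.1,
    fun p hp μ₀ hμ₀ => wPrime_zero_rpow hY hne hp hμ₀, fun μ ν hμ hν => ?_⟩
  · refine le_iInf fun μ₁ => le_iInf fun μ₀ => le_iInf fun ν₁ => le_iInf fun ν₀ =>
      le_iInf fun h₁ => le_iInf fun h₂ => le_iInf fun h₃ => le_iInf fun h₄ => ?_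
    simpa only [ENNReal.rpow_one] using
      wZero_rpow_le_decomposition hX hYo hYuniv le_rfl hμ.1 hν.1 h₁ h₂ h₃
  · exact le_iInf fun μ₁ => le_iInf fun μ₀ => le_iInf fun ν₁ => le_iInf fun ν₀ =>
      le_iInf fun h₁ => le_iInf fun h₂ => le_iInf fun h₃ => le_iInf fun h₄ =>
      wZero_rpow_le_decomposition hX hYo hYuniv hp hμ.1 hν.1 h₁ h₂ h₃
  · rw [wPrime_one_eq_freeCost hY hne hμ.1 hν.1]
    refine iInf_congr fun μ₁ => iInf_congr fun μ₀ => iInf_congr fun ν₁ => iInf_congr fun ν₀ =>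
      iInf_congr fun h₁ => iInf_congr fun h₂ => ?_
    rw [wPrime_zero_one hY hne (hμ.1.of_add_right h₁),
      wPrime_zero_one hY hne (hν.1.of_add_right h₂)]
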